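/- For a commutative ring $A$ with $1$ and $n\ge 1$, let $S_n(A)=\{\sum_{i=1}^n a_i^2 : a_i\in A\}$ and $S(A)=\bigcup_{n\ge 1}S_n(A)$. The length of $a\in S(A)$ is the least $n\ge 1$ with $a\in S_n(A)$, and the Pythagoras number $P(A)\in\mathbb{N}\cup\{\infty\}$ is the supremum of the lengths of the elements of $S(A)$. Let $k$ be a real closed field, and let $A$ be a finitely generated commutative $k$-algebra. Let $W$ be the Zariski closure in $\operatorname{Spec}(A)$ of the set of $k$-points of $\operatorname{Spec}(A)$. If $\dim(W)\le 1$, then $P(A)$ is finite. -/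

import Mathlib

/-- `S_n(A)`: the elements of `A` that are sums of `n` squares. -/
def sumsOfNSquares (A : Type*) [CommRing A] (n : ℕ) : Set A :=
  {x | ∃ a : Fin n → A, x = ∑ i, a i ^ 2}

/-- `S(A) = ⋃_{n ≥ 1} S_n(A)`: the elements of `A` that are sums of squares. -/
def sumsOfSquares (A : Type*) [CommRing A] : Set A :=
  ⋃ n ≥ 1, sumsOfNSquares A n

/-- The length of `a ∈ S(A)`: the least `n ≥ 1` with `a ∈ S_n(A)`.
The value outside `S(A)` is never used. -/
noncomputable def squareLength {A : Type*} [CommRing A] (a : A) : ℕ :=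
  sInf {n : ℕ | 1 ≤ n ∧ a ∈ sumsOfNSquares A n}

/-- The Pythagoras number `P(A) ∈ ℕ ∪ {∞}`: the supremum of the lengths of the elements of
`S(A)`. -/
noncomputable def pythagorasNumber (A : Type*) [CommRing A] : ℕ∞ :=
  ⨆ a ∈ sumsOfSquares A, (squareLength a : ℕ∞)

/-- The set of `k`-points of `Spec A`: the prime ideals that are kernels of `k`-algebra
homomorphisms `A → k`. -/
def rationalPoints (k A : Type*) [Field k] [CommRing A] [Algebra k A] :
    Set (PrimeSpectrum A) :=
  {p | ∃ φ : A →ₐ[k] k, RingHom.ker φ = p.asIdeal}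

section

open Polynomial IntermediateField

/-! ### Real closed fields -/

namespace IsRealClosed

section Order

variable {k : Type*} [Field k] [IsRealClosed k]

/-! Let `I` be the ideal of all `x` such that `x` and `-x` are sums of squares (`sumSqSupport`). By
the real Nullstellensatz a function vanishing at all `k`-points has a power in `I`, so `V(I)` lies
in `W` and `A/I` has dimension at most one. Two bounds then add up. Elements of `I` have bounded
length, because `I` is finitely generated and `cg = ((c+1)/2)² g + ((c-1)/2)² (-g)`. Sums of squares
in `A/I` have bounded length, because `A/I` is finite over `k[X]`, say with `n` generators: a sum of
squares depends only on the Gram matrix `NᵀN` of its coefficient matrix, and every such matrix is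
`AᵀA + BᵀB` with `A`, `B` of size `n × n`, so `2n` squares suffice.

The Gram statement comes from `k(i)[X]`, where one square matrix is enough
(`exists_square_conjTranspose_mul_self_eq`). By induction on `n`: for `a = G₀₀ ≠ 0`, Lagrange's
identity makes the Schur complement of `a` a Gram matrix, so `aG` is the Gram matrix of a square
matrix. The factor `a` is divided out two linear factors at a time, using matrices that are unitary
up to `(X - z)(X - z̄)`.

For the Nullstellensatz, a minimal prime over `I` has a semireal residue field, which embeds into a
real closed field `R`. Artin–Lang (`exists_specialization`) turns the resulting `R`-point into a
`k`-point. Induction on the number of coordinates reduces it to algebraic functions of one variable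
`t`. There Hermite's method applies: the signs of the diagonalized trace form of a polynomial detect
whether it has a root, and some `a` in `k` gives these entries the same signs as `t` does. -/

theorem isSquare_of_isSumSq {x : k} (hx : IsSumSq x) : IsSquare x := by
  rcases isSquare_or_isSquare_neg x with h | ⟨r, hr⟩
  · exact h
  · by_cases h0 : r = 0
    · have : x = 0 := by rw [h0] at hr; simpa using hr
      exact this ▸ ⟨0, by simp⟩
    · exfalso
      refine IsSemireal.not_isSumSq_neg_one k ?_
      have : (-1 : k) = x * (r⁻¹ * r⁻¹) := by
        have hx : x = -(r * r) := by rw [← hr]; simp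
        rw [hx]; field_simp
      rw [this]
      exact hx.mul (IsSumSq.mul_self _)

theorem eq_zero_of_isSquare_of_isSquare_neg {x : k} (h : IsSquare x) (h' : IsSquare (-x)) :
    x = 0 := by
  obtain ⟨a, rfl⟩ := h
  obtain ⟨b, hb⟩ := h'
  by_contra hne
  have ha : a ≠ 0 := fun h => hne (by simp [h])
  refine IsSemireal.not_isSumSq_neg_one k ?_
  have : (-1 : k) = (b * a⁻¹) * (b * a⁻¹) := by
    have : (b * a⁻¹) * (b * a⁻¹) = (b * b) * (a⁻¹ * a⁻¹) := by ring
    rw [this, ← hb]; field_simp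
  rw [this]
  exact IsSumSq.mul_self _

variable (k) in
/-- The linear order of a real closed field, whose nonnegative elements are the squares. -/
noncomputable abbrev linearOrder : LinearOrder k where
  le a b := IsSquare (b - a)
  le_refl a := ⟨0, by simp⟩
  le_trans a b c hab hbc := by
    have := isSquare_of_isSumSq (hab.isSumSq.add hbc.isSumSq)
    simpa using this
  le_antisymm a b hab hba := by
    have := eq_zero_of_isSquare_of_isSquare_neg hab (by simpa using hba)
    exact (sub_eq_zero.mp this).symm
  le_total a b := by
    have := isSquare_or_isSquare_neg (b - a)
    simpa using this
  toDecidableLE := Classical.decRel _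

theorem isStrictOrderedRing :
    letI := linearOrder k
    IsStrictOrderedRing k := by
  let := linearOrder k
  have hadd : IsOrderedAddMonoid k :=
    { add_le_add_left := fun a b hab c => by
        change IsSquare _
        have : IsSquare (b - a) := hab
        simpa using this }
  have h01 : ZeroLEOneClass k := ⟨by change IsSquare _; exact ⟨1, by simp⟩⟩
  have : IsOrderedRing k := .of_mul_nonneg fun x y hx hy => by
    change IsSquare _
    have h1 : IsSquare (x - 0) := hx
    have h2 : IsSquare (y - 0) := hy
    simpa using h1.mul h2
  exact IsOrderedRing.toIsStrictOrderedRing k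

end Order

/-! ### Algebraic closedness of `k(i)` by Galois theory -/

section AlgClosed

variable {k : Type*} [Field k] [IsRealClosed k]

/-- In an algebraic closure of `k`, elements of `k(i)` are squares of elements of `k(i)`. -/
theorem exists_sq_eq_add_mul_I {Ω : Type*} [Field Ω] [Algebra k Ω] {i : Ω} (hi : i * i = -1)
    (a b : k) : ∃ c d : k, algebraMap k Ω a + algebraMap k Ω b * i =
      (algebraMap k Ω c + algebraMap k Ω d * i) * (algebraMap k Ω c + algebraMap k Ω d * i) := by
  let := linearOrder k
  have := isStrictOrderedRing (k := k)
  -- `r` is the modulus of `a + bi`. A square root has real and imaginary parts `√((r+a)/2)` and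
  -- `√((r-a)/2)`, with signs chosen so that `2cd = b`.
  obtain ⟨r, hr⟩ := isSquare_of_isSumSq ((IsSumSq.mul_self a).add (IsSumSq.mul_self b))
  wlog hr0 : 0 ≤ r generalizing r
  · exact this (-r) (by simpa using hr) (by linarith [not_le.mp hr0])
  have har : |a| ≤ r := abs_le_of_sq_le_sq (by nlinarith [mul_self_nonneg b]) hr0
  have h1 : 0 ≤ (r + a) / 2 := by linarith [neg_abs_le a]
  have h2 : 0 ≤ (r - a) / 2 := by linarith [le_abs_self a]
  obtain ⟨c, hc⟩ := nonneg_iff_isSquare.mp h1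
  obtain ⟨d, hd⟩ := nonneg_iff_isSquare.mp h2
  have hcd : (2 * c * d) * (2 * c * d) = b * b := by
    have : (2 * c * d) * (2 * c * d) = 4 * (c * c) * (d * d) := by ring
    rw [this, ← hc, ← hd]; linear_combination -hr
  have key : ∀ d' : k, d' * d' = (r - a) / 2 → 2 * c * d' = b →
      algebraMap k Ω a + algebraMap k Ω b * i =
      (algebraMap k Ω c + algebraMap k Ω d' * i) * (algebraMap k Ω c + algebraMap k Ω d' * i) := by
    intro d' hd' hb
    have e1 : a = c * c - d' * d' := by rw [hd', ← hc]; ring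
    have e2 : algebraMap k Ω a = algebraMap k Ω c * algebraMap k Ω c
        - algebraMap k Ω d' * algebraMap k Ω d' := by rw [e1]; simp
    have e3 : algebraMap k Ω b = 2 * algebraMap k Ω c * algebraMap k Ω d' := by
      rw [← hb, map_mul, map_mul, map_ofNat]
    rw [e2, e3]; linear_combination (-(algebraMap k Ω d') ^ 2) * hi
  rcases mul_self_eq_mul_self_iff.mp hcd with h | h
  · exact ⟨c, d, key d hd.symm h⟩
  · exact ⟨c, -d, key (-d) (by simpa using hd.symm) (by linear_combination -h)⟩

theorem natDegree_minpoly_eq_one_of_odd {E : Type*} [Field E] [Algebra k E] {x : E}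
    (hx : IsIntegral k x) (ho : Odd (minpoly k x).natDegree) : (minpoly k x).natDegree = 1 := by
  obtain ⟨r, hr⟩ := exists_isRoot_of_odd_natDegree ho
  exact natDegree_eq_of_degree_eq_some (degree_eq_one_of_irreducible_of_root (minpoly.irreducible hx) hr)

/-- The fixed field of a Sylow 2-subgroup has odd degree over `k`, so its elements have minimal
polynomials of odd degree, which are linear. Hence it equals `k`, and the Sylow subgroup is the
whole group. -/
theorem card_gal_eq_two_pow (E : Type*) [Field E] [Algebra k E] [FiniteDimensional k E]
    [IsGalois k E] : ∃ e, Nat.card Gal(E/k) = 2 ^ e := by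
  classical
  have : Fact (Nat.Prime 2) := ⟨Nat.prime_two⟩
  let P : Sylow 2 Gal(E/k) := default
  obtain ⟨e, he⟩ := P.2.exists_card_eq
  refine ⟨e, ?_⟩
  have hodd : Odd (Module.finrank k (fixedField (P : Subgroup Gal(E/k)))) := by
    have h1 := P.not_dvd_index
    rw [← Nat.not_even_iff_odd, even_iff_two_dvd]
    have h2 := (P : Subgroup Gal(E/k)).card_mul_index
    rw [IsGalois.card_aut_eq_finrank, ← finrank_fixedField_eq_card,
      ← Module.finrank_mul_finrank k (fixedField (P : Subgroup Gal(E/k))) E, mul_comm] at h2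
    rwa [← Nat.eq_of_mul_eq_mul_right Module.finrank_pos h2]
  have hbot : fixedField (P : Subgroup Gal(E/k)) = ⊥ := by
    refine eq_bot_iff.mpr fun x hx => ?_
    have hint : IsIntegral k (⟨x, hx⟩ : fixedField (P : Subgroup Gal(E/k))) :=
      Algebra.IsIntegral.isIntegral _
    have hd : (minpoly k (⟨x, hx⟩ : fixedField (P : Subgroup Gal(E/k)))).natDegree ∣ _ :=
      minpoly.degree_dvd hint
    have h1 := natDegree_minpoly_eq_one_of_odd hint (hodd.of_dvd_nat hd)
    have h2 := minpoly.mem_range_of_degree_eq_one k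
      (⟨x, hx⟩ : fixedField (P : Subgroup Gal(E/k)))
      ((degree_eq_iff_natDegree_eq (minpoly.ne_zero hint)).mpr h1)
    obtain ⟨y, hy⟩ := h2
    exact mem_bot.mpr ⟨y, congrArg Subtype.val hy⟩
  have htop : (P : Subgroup Gal(E/k)) = ⊤ := by
    rw [← fixingSubgroup_fixedField (P : Subgroup Gal(E/k)), hbot, fixingSubgroup_bot]
  rw [← he]
  have : Nat.card (P : Subgroup Gal(E/k)) = Nat.card (⊤ : Subgroup Gal(E/k)) := by rw [htop]
  rw [Subgroup.card_top] at this
  exact this.symm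

/-- A field of characteristic not two in which all elements are squares has no nontrivial
Galois extension of `2`-power degree. -/
theorem _root_.eq_zero_of_card_gal_eq_two_pow {F E : Type*} [Field F] [Field E] [Algebra F E]
    [FiniteDimensional F E] [IsGalois F E] [NeZero (2 : F)] (hF : ∀ x : F, IsSquare x) {e : ℕ}
    (he : Nat.card Gal(E/F) = 2 ^ e) : e = 0 := by
  by_contra hne
  obtain ⟨n, rfl⟩ := Nat.exists_eq_succ_of_ne_zero hne
  have : Fact (Nat.Prime 2) := ⟨Nat.prime_two⟩
  -- A subgroup of index 2 has a quadratic fixed field, but the quadratic formula already gives the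
  -- minimal polynomial of a generator a root in `F`.
  obtain ⟨H, hH⟩ := Sylow.exists_subgroup_card_pow_prime (G := Gal(E/F)) 2 (n := n)
    (by rw [he]; exact pow_dvd_pow _ (Nat.le_succ n))
  have h2 : Module.finrank F (fixedField H) = 2 := by
    have h := Module.finrank_mul_finrank F (fixedField H) E
    rw [finrank_fixedField_eq_card, ← IsGalois.card_aut_eq_finrank F E, he, hH, pow_succ, mul_comm] at h
    exact Nat.eq_of_mul_eq_mul_left (by positivity) h
  have hne : fixedField H ≠ ⊥ := fun h => by rw [h, IntermediateField.finrank_bot] at h2; norm_num at h2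
  obtain ⟨x, hx, hxb⟩ := SetLike.exists_of_lt (bot_lt_iff_ne_bot.mpr hne)
  set y : fixedField H := ⟨x, hx⟩
  have hint : IsIntegral F y := Algebra.IsIntegral.isIntegral _
  have hle : (minpoly F y).natDegree ≤ 2 := h2 ▸ minpoly.natDegree_le y
  have hroot : ¬ (minpoly F y).degree = 1 := fun h => by
    obtain ⟨z, hz⟩ := minpoly.mem_range_of_degree_eq_one F y h
    exact hxb (mem_bot.mpr ⟨z, congrArg Subtype.val hz⟩)
  have hpos := minpoly.natDegree_pos hint
  have hd : (minpoly F y).natDegree = 2 := by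
    have : (minpoly F y).natDegree ≠ 1 := fun h =>
      hroot ((degree_eq_iff_natDegree_eq (minpoly.ne_zero hint)).mpr h)
    omega
  have hm := minpoly.monic hint
  set p := minpoly F y
  have hp : p = X ^ 2 + C (p.coeff 1) * X + C (p.coeff 0) := by
    conv_lhs => rw [p.as_sum_range_C_mul_X_pow, hd]
    have : p.coeff 2 = 1 := by rw [← hd]; exact hm
    simp [Finset.sum_range_succ, this]; ring
  obtain ⟨s, hs⟩ := hF (discrim 1 (p.coeff 1) (p.coeff 0))
  obtain ⟨z, hz⟩ := exists_quadratic_eq_zero (one_ne_zero) ⟨s, hs⟩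
  refine hroot (degree_eq_one_of_irreducible_of_root (minpoly.irreducible hint) (x := z) ?_)
  rw [hp, IsRoot]
  simp only [eval_add, eval_pow, eval_X, eval_mul, eval_C]
  linear_combination hz

/-- Every element of an algebraic closure of `k` is of the form `a + b i` with `a, b ∈ k`. -/
theorem exists_eq_add_mul_I {Ω : Type*} [Field Ω] [Algebra k Ω] [Algebra.IsAlgebraic k Ω]
    [IsAlgClosed Ω] {i : Ω} (hi : i * i = -1) (x : Ω) :
    ∃ a b : k, x = algebraMap k Ω a + algebraMap k Ω b * i := by
  have : Normal k Ω := by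
    have : IsAlgClosure k Ω := ⟨inferInstance, inferInstance⟩
    exact IsAlgClosure.normal k Ω
  let E₀ : IntermediateField k Ω := k⟮i, x⟯
  have : FiniteDimensional k E₀ := finiteDimensional_adjoin
    fun y _ => Algebra.IsIntegral.isIntegral y
  let E := normalClosure k E₀ Ω
  have hE₀ : E₀ ≤ E := le_normalClosure _
  have : Normal k E := normalClosure.normal k E₀ Ω
  have : IsGalois k E := ⟨⟩
  have : FiniteDimensional k E := normalClosure.is_finiteDimensional k E₀ Ω
  let j : E := ⟨i, hE₀ (subset_adjoin _ _ (by simp))⟩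
  have hj : j * j = -1 := Subtype.ext hi
  -- All elements of `M = k(i)` are squares and `Gal(E/M)` has 2-power order, so `E = M`; this puts
  -- `x` in `k(i)`.
  let M : IntermediateField k E := k⟮j⟯
  have hM : ∀ y : E, y ∈ M ↔ ∃ a b : k, y = algebraMap k E a + algebraMap k E b * j := by
    let S : Subalgebra k E :=
      { carrier := {y | ∃ a b : k, y = algebraMap k E a + algebraMap k E b * j}
        mul_mem' := by
          rintro _ _ ⟨a, b, rfl⟩ ⟨c, d, rfl⟩
          refine ⟨a * c - b * d, a * d + b * c, ?_⟩
          simp only [map_sub, map_add, map_mul]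
          linear_combination (algebraMap k E b * algebraMap k E d) * hj
        add_mem' := by
          rintro _ _ ⟨a, b, rfl⟩ ⟨c, d, rfl⟩
          exact ⟨a + c, b + d, by simp only [map_add]; ring⟩
        algebraMap_mem' := fun a => ⟨a, 0, by simp⟩ }
    have hS : ∀ y ∈ S, y ∈ M := by
      rintro y ⟨a, b, rfl⟩
      exact add_mem (M.algebraMap_mem a) (mul_mem (M.algebraMap_mem b)
        (mem_adjoin_simple_self k j))
    intro y
    refine ⟨fun hy => ?_, fun hy => hS y hy⟩
    have h1 : M.toSubalgebra = Algebra.adjoin k {j} :=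
      adjoin_simple_toSubalgebra_of_isAlgebraic (Algebra.IsAlgebraic.isAlgebraic j)
    have h2 : Algebra.adjoin k {j} ≤ S := Algebra.adjoin_le (by
      rintro _ rfl
      exact ⟨0, 1, by simp⟩)
    exact h2 (h1 ▸ hy)
  obtain ⟨e, he⟩ := card_gal_eq_two_pow (k := k) E
  have hMe : ∃ e', Nat.card Gal(E/M) = 2 ^ e' := by
    have : Module.finrank k M * Module.finrank M E = 2 ^ e := by
      rw [Module.finrank_mul_finrank, ← IsGalois.card_aut_eq_finrank, he]
    obtain ⟨e', -, h⟩ := (Nat.dvd_prime_pow Nat.prime_two).mp (Dvd.intro_left _ this)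
    exact ⟨e', by rw [IsGalois.card_aut_eq_finrank, h]⟩
  obtain ⟨e', he'⟩ := hMe
  have hsq : ∀ z : M, IsSquare z := by
    rintro ⟨z, hz⟩
    obtain ⟨a, b, rfl⟩ := (hM z).mp hz
    obtain ⟨c, d, hcd⟩ := exists_sq_eq_add_mul_I (k := k) hj a b
    exact ⟨⟨_, (hM _).mpr ⟨c, d, rfl⟩⟩, Subtype.ext hcd⟩
  have h0 := eq_zero_of_card_gal_eq_two_pow hsq he'
  rw [h0, pow_zero, IsGalois.card_aut_eq_finrank] at he'
  have hxE : x ∈ E := hE₀ (subset_adjoin _ _ (by simp))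
  obtain ⟨⟨y, hy⟩, hyx⟩ := (Algebra.finrank_eq_one_iff_bijective_algebraMap.mp he').2 ⟨x, hxE⟩
  obtain ⟨a, b, hab⟩ := (hM y).mp hy
  refine ⟨a, b, ?_⟩
  have h3 : y = ⟨x, hxE⟩ := hyx
  rw [hab] at h3
  exact (congrArg Subtype.val h3).symm

end AlgClosed

end IsRealClosed

end

section

open Polynomial IntermediateField

/-! ### The algebraic closure of a real closed field -/

theorem IsSumSq.map_ringHom {A B : Type*} [CommRing A] [CommRing B] (f : A →+* B) {s : A}
    (hs : IsSumSq s) : IsSumSq (f s) := by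
  induction hs with
  | zero => simp
  | sq_add a _ ih => rw [map_add, map_mul]; exact (IsSumSq.mul_self _).add ih

namespace IsRealClosed

variable (k : Type*) [Field k]

/-- The quadratic extension `k(i)` of a field `k`. -/
abbrev Cx : Type _ := QuadraticAlgebra k (-1) 0

variable {k} [IsRealClosed k]

/-- This condition makes `Cx k` a field. -/
instance : Fact (∀ r : k, r ^ 2 ≠ -1 + 0 * r) :=
  ⟨fun r h => IsSemireal.not_isSumSq_neg_one k (by
    have : (-1 : k) = r * r := by linear_combination -h
    rw [this]; exact IsSumSq.mul_self r)⟩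

instance : IsAlgClosed (Cx k) := by
  let Ω := AlgebraicClosure (Cx k)
  let i : Ω := algebraMap (Cx k) Ω QuadraticAlgebra.omega
  have hi : i * i = -1 := by
    rw [← map_mul, QuadraticAlgebra.omega_mul_omega_eq_add]
    simp
  have : Algebra.IsAlgebraic k Ω := Algebra.IsAlgebraic.trans k (Cx k) Ω
  refine IsAlgClosed.of_ringEquiv Ω (Cx k) (RingEquiv.ofBijective (algebraMap (Cx k) Ω)
    ⟨(algebraMap (Cx k) Ω).injective, fun x => ?_⟩).symm
  obtain ⟨a, b, h⟩ := exists_eq_add_mul_I (k := k) hi x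
  refine ⟨algebraMap k (Cx k) a + algebraMap k (Cx k) b * QuadraticAlgebra.omega, ?_⟩
  rw [h, map_add, map_mul, ← IsScalarTower.algebraMap_apply, ← IsScalarTower.algebraMap_apply]

theorem natDegree_le_two_of_irreducible {p : k[X]} (hp : Irreducible p) : p.natDegree ≤ 2 := by
  obtain ⟨z, hz⟩ := IsAlgClosed.exists_aeval_eq_zero (Cx k) p
    (degree_pos_of_irreducible hp).ne'
  have h1 := minpoly.natDegree_le (A := k) z
  rw [QuadraticAlgebra.finrank_eq_two] at h1
  rwa [← natDegree_eq_of_degree_eq (degree_eq_degree_of_associated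
    ((minpoly.irreducible (Algebra.IsIntegral.isIntegral z)).associated_of_dvd hp
      (minpoly.dvd k z hz)))]

/-- An irreducible polynomial over a real closed field is linear or a positive multiple of
a sum `(X - b)² + c²` with `c ≠ 0`, up to a constant. -/
theorem eq_linear_or_quadratic_of_irreducible {p : k[X]} (hp : Irreducible p) :
    (∃ u r : k, u ≠ 0 ∧ p = C u * (X - C r)) ∨
      ∃ u b c : k, u ≠ 0 ∧ c ≠ 0 ∧ p = C u * ((X - C b) ^ 2 + C c ^ 2) := by
  have hp0 := hp.ne_zero
  have h2 := natDegree_le_two_of_irreducible hp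
  have h1 : 0 < p.natDegree := natDegree_pos_iff_degree_pos.mpr (degree_pos_of_irreducible hp)
  rcases Nat.lt_or_ge p.natDegree 2 with h | h
  · left
    have hd : p.natDegree = 1 := by omega
    obtain ⟨a, ha, b, rfl⟩ := natDegree_eq_one.mp hd
    exact ⟨a, -b / a, ha, by
      rw [mul_sub, ← C_mul, mul_div_cancel₀ _ ha]; simp⟩
  · right
    have hd : p.natDegree = 2 := by omega
    set a := p.coeff 2
    set b := p.coeff 1
    set c := p.coeff 0
    have ha : a ≠ 0 := by
      have := leadingCoeff_ne_zero.mpr hp0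
      rwa [leadingCoeff, hd] at this
    have hpe : p = C a * X ^ 2 + C b * X + C c := by
      conv_lhs => rw [p.as_sum_range_C_mul_X_pow, hd]
      simp [Finset.sum_range_succ]; ring
    have hnr : ∀ r, ¬ p.IsRoot r := fun r hr => by
      rw [natDegree_eq_of_degree_eq_some (degree_eq_one_of_irreducible_of_root hp hr)] at hd
      norm_num at hd
    -- Completing the square leaves the constant `t`. If `-t` were a square, `p` would have a root;
    -- so `t` is a square, and nonzero for the same reason.
    let t := c / a - (b / (2 * a)) ^ 2
    have hdecomp : p = C a * ((X - C (-b / (2 * a))) ^ 2 + C t) := by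
      rw [hpe]
      have e1 : b = 2 * a * (b / (2 * a)) := by field_simp
      have e2 : c = a * (t + (b / (2 * a)) ^ 2) := by simp only [t]; field_simp; ring
      have e3 : -b / (2 * a) = -(b / (2 * a)) := by ring
      rw [e3]
      generalize b / (2 * a) = s at *
      rw [e1, e2]
      simp only [C_mul, C_add, C_pow, C_neg, C_ofNat]
      ring
    rcases isSquare_or_isSquare_neg t with ⟨s, hs⟩ | ⟨s, hs⟩
    · refine ⟨a, -b / (2 * a), s, ha, fun h0 => ?_, ?_⟩
      · refine hnr (-b / (2 * a)) ?_
        rw [hdecomp, hs, h0]; simp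
      · rw [← C_pow, pow_two s, ← hs]; exact hdecomp
    · exfalso
      refine hnr (-b / (2 * a) + s) ?_
      rw [hdecomp, IsRoot]
      simp only [eval_mul, eval_C, eval_add, eval_pow, eval_sub, eval_X]
      linear_combination -a * hs

/-- A field extension of `k` in which `-1` is not a square contains no further algebraic
elements. -/
theorem mem_range_of_isAlgebraic {R : Type*} [Field R] [Algebra k R] [IsSemireal R] {x : R}
    (hx : IsAlgebraic k x) : x ∈ (algebraMap k R).range := by
  rcases eq_linear_or_quadratic_of_irreducible (minpoly.irreducible hx.isIntegral) with
    ⟨u, r, hu, h⟩ | ⟨u, b, c, hu, hc, h⟩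
  · have h0 := minpoly.aeval k x
    rw [h] at h0
    simp only [map_mul, aeval_C, map_sub, aeval_X, mul_eq_zero, FaithfulSMul.algebraMap_eq_zero_iff,
      hu, false_or, sub_eq_zero] at h0
    exact ⟨r, h0.symm⟩
  · have h0 := minpoly.aeval k x
    rw [h] at h0
    simp only [map_mul, aeval_C, map_sub, aeval_X, mul_eq_zero, FaithfulSMul.algebraMap_eq_zero_iff,
      hu, false_or, map_add, map_pow] at h0
    exfalso
    have hc' : algebraMap k R c ≠ 0 := by simpa using hc
    refine IsSemireal.not_isSumSq_neg_one R ?_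
    set y := (x - algebraMap k R b) * (algebraMap k R c)⁻¹
    have : (-1 : R) = y * y := by
      simp only [y]; field_simp; linear_combination -h0
    rw [this]
    exact IsSumSq.mul_self _

/-- A subfield of a real closed field which is algebraically closed in it is real closed. -/
theorem of_forall_isAlgebraic_mem {F R : Type*} [Field F] [Field R] [IsRealClosed R] [Algebra F R]
    (K : IntermediateField F R) (hK : ∀ x : R, IsAlgebraic K x → x ∈ K) : IsRealClosed K where
  one_add_ne_zero {s} hs h := by
    have h1 := hs.map_ringHom (algebraMap K R)
    refine IsSemireal.one_add_ne_zero h1 ?_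
    rw [← map_one (algebraMap K R), ← map_add, h, map_zero]
  isSquare_or_isSquare_neg x := by
    have key : ∀ y : K, IsSquare (y : R) → IsSquare y := by
      rintro y ⟨r, hr⟩
      have hr' : IsAlgebraic K r := by
        refine IsAlgebraic.of_pow (n := 2) two_pos ?_
        rw [pow_two, ← hr]
        exact isAlgebraic_algebraMap y
      exact ⟨⟨r, hK r hr'⟩, Subtype.ext hr⟩
    rcases isSquare_or_isSquare_neg (x : R) with h | h
    · exact Or.inl (key x h)
    · exact Or.inr (key (-x) (by simpa using h))
  exists_isRoot_of_odd_natDegree {f} hf := by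
    obtain ⟨x, hx⟩ := exists_isRoot_of_odd_natDegree (R := R) (f := f.map (algebraMap K R))
      (by rwa [natDegree_map])
    have hf0 : f ≠ 0 := by rintro rfl; simp at hf
    have hx' : aeval x f = 0 := by rwa [IsRoot, eval_map_algebraMap] at hx
    have hxK : x ∈ K := hK x ⟨f, hf0, hx'⟩
    refine ⟨⟨x, hxK⟩, (algebraMap K R).injective ?_⟩
    rw [map_zero, ← coe_aeval_eq_eval, ← aeval_algebraMap_apply]
    exact hx'

end IsRealClosed

end

section

open Polynomial IntermediateField

/-! ### Existence of real closures -/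

section RealClosure

variable {M : Type*} [Field M]

theorem IsSumSq.mul_self_add_ne_zero [IsSemireal M] {a s : M} (ha : a ≠ 0) (hs : IsSumSq s) : a * a + s ≠ 0 := by
  intro h
  refine IsSemireal.one_add_ne_zero (s := s * (a⁻¹ * a⁻¹)) (hs.mul (IsSumSq.mul_self _)) ?_
  have : s = -(a * a) := by linear_combination h
  rw [this]; field_simp; ring

/-- Leading coefficients of squares cannot cancel, since a sum of squares in a semireal field
vanishes only trivially. -/
theorem IsSumSq.even_natDegree_and_leadingCoeff [IsSemireal M] {G : M[X]} (hG : IsSumSq G) :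
    Even G.natDegree ∧ IsSumSq G.leadingCoeff := by
  induction hG with
  | zero => simp
  | @sq_add p s _ ih =>
    by_cases hp : p = 0
    · simpa [hp] using ih
    by_cases hs : s = 0
    · simp only [hs, add_zero, natDegree_mul hp hp, leadingCoeff_mul]
      exact ⟨⟨_, rfl⟩, IsSumSq.mul_self _⟩
    have hpp : p * p ≠ 0 := mul_ne_zero hp hp
    rcases lt_trichotomy (p * p).degree s.degree with h | h | h
    · rw [leadingCoeff_add_of_degree_lt h, natDegree_add_eq_right_of_degree_lt h]
      exact ih
    · have hl : (p * p).leadingCoeff + s.leadingCoeff ≠ 0 := by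
        rw [leadingCoeff_mul]
        exact ih.2.mul_self_add_ne_zero (leadingCoeff_ne_zero.mpr hp)
      have hd : (p * p + s).degree = s.degree := by
        rw [degree_add_eq_of_leadingCoeff_add_ne_zero hl, h, max_self]
      rw [leadingCoeff_add_of_degree_eq h hl, natDegree_eq_of_degree_eq hd, leadingCoeff_mul]
      exact ⟨ih.1, (IsSumSq.mul_self _).add ih.2⟩
    · rw [leadingCoeff_add_of_degree_lt' h, natDegree_add_eq_left_of_degree_lt h,
        natDegree_mul hp hp, leadingCoeff_mul]
      exact ⟨⟨_, rfl⟩, IsSumSq.mul_self _⟩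

variable {Ω : Type*} [Field Ω] [Algebra M Ω]

/-- Each summand is represented by its remainder modulo the minimal polynomial. The degree bound
drives the descent on odd degrees in `IsRealClosed.of_maximal`. -/
theorem exists_isSumSq_polynomial_of_isSumSq_adjoin {x : Ω} (hx : IsIntegral M x) {z : M⟮x⟯}
    (hz : IsSumSq z) : ∃ G : M[X], IsSumSq G ∧ G.natDegree ≤ 2 * ((minpoly M x).natDegree - 1) ∧
      aeval x G = z := by
  induction hz with
  | zero => exact ⟨0, IsSumSq.zero, by simp, by simp⟩
  | @sq_add a s _ ih =>
    obtain ⟨G, hG, hd, hs⟩ := ih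
    have h1 : M⟮x⟯.toSubalgebra = Algebra.adjoin M {x} :=
      adjoin_simple_toSubalgebra_of_isAlgebraic hx.isAlgebraic
    have h2 : (a : Ω) ∈ Algebra.adjoin M {x} := h1 ▸ a.2
    rw [Algebra.adjoin_singleton_eq_range_aeval] at h2
    obtain ⟨g, hg⟩ := h2
    have hg' : aeval x (g %ₘ minpoly M x) = a := by
      rw [aeval_modByMonic_eq_self_of_root (minpoly.aeval M x)]; exact hg
    have hdeg : (g %ₘ minpoly M x).natDegree ≤ (minpoly M x).natDegree - 1 :=
      Nat.le_sub_one_of_lt (natDegree_modByMonic_lt _ (minpoly.monic hx) (minpoly.ne_one M x))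
    refine ⟨(g %ₘ minpoly M x) * (g %ₘ minpoly M x) + G, (IsSumSq.mul_self _).add hG, ?_, ?_⟩
    · refine (natDegree_add_le _ _).trans (max_le ?_ hd)
      exact natDegree_mul_le.trans (by omega)
    · rw [map_add, map_mul, hg', hs]; rfl

/-- Maximality makes `-1` a sum of squares in `M(x)` for every `x` outside `M`. For `x = √a` this
makes `-a` a sum of squares. For a root `x` of an irreducible `f` of odd degree it gives `1 + G = f
h` with `h` of smaller odd degree, and a root of `h` contradicts semireality. -/
theorem IsRealClosed.of_maximal [IsSemireal M] [IsAlgClosed Ω] [Algebra.IsAlgebraic M Ω]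
    (hmax : ∀ x : Ω, IsSemireal M⟮x⟯ → x ∈ (algebraMap M Ω).range) : IsRealClosed M := by
  have hadj : ∀ x : Ω, x ∉ (algebraMap M Ω).range → ∃ G : M[X], IsSumSq G ∧
      G.natDegree ≤ 2 * ((minpoly M x).natDegree - 1) ∧ aeval x G = -1 := by
    intro x hx
    have h1 : IsSumSq (-1 : M⟮x⟯) := by
      by_contra h
      exact hx (hmax x (isSemireal_iff_not_isSumSq_neg_one.mpr h))
    obtain ⟨G, hG, hd, h⟩ := exists_isSumSq_polynomial_of_isSumSq_adjoin
      (Algebra.IsIntegral.isIntegral x) h1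
    exact ⟨G, hG, hd, by rw [h]; rfl⟩
  have hsq : ∀ a : M, ¬ IsSquare a → IsSumSq (-a) := by
    intro a ha
    obtain ⟨s, hs⟩ := IsAlgClosed.exists_pow_nat_eq (algebraMap M Ω a) two_pos
    have hs0 : s ∉ (algebraMap M Ω).range := by
      rintro ⟨b, rfl⟩
      exact ha ⟨b, (algebraMap M Ω).injective (by rw [← hs, map_mul, pow_two])⟩
    obtain ⟨G, hG, -, h⟩ := hadj s hs0
    -- The square of `b + cs` is `b² + ac² + 2bcs`, because `s² = a`.
    have key : ∀ G : M[X], IsSumSq G → ∃ p q r : M, IsSumSq p ∧ IsSumSq q ∧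
        aeval s G = algebraMap M Ω (p + a * q) + algebraMap M Ω r * s := by
      intro G hG
      induction hG with
      | zero => exact ⟨0, 0, 0, .zero, .zero, by simp⟩
      | @sq_add g G _ ih =>
        obtain ⟨p, q, r, hp, hq, h⟩ := ih
        have hlin : ∃ b c : M, aeval s g = algebraMap M Ω b + algebraMap M Ω c * s := by
          have hm : (X ^ 2 - C a : M[X]).Monic := monic_X_pow_sub_C a two_ne_zero
          have hr : aeval s (X ^ 2 - C a : M[X]) = 0 := by simp [hs]
          rw [← aeval_modByMonic_eq_self_of_root hr]
          have hd : (g %ₘ (X ^ 2 - C a)).natDegree ≤ 1 := by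
            have := natDegree_modByMonic_lt g hm
              (fun h1 => by simpa using congrArg natDegree h1)
            rw [natDegree_X_pow_sub_C] at this
            omega
          refine ⟨(g %ₘ (X ^ 2 - C a)).coeff 0, (g %ₘ (X ^ 2 - C a)).coeff 1, ?_⟩
          conv_lhs => rw [eq_X_add_C_of_natDegree_le_one hd]
          simp [add_comm]
        obtain ⟨b, c, hbc⟩ := hlin
        refine ⟨b * b + p, c * c + q, 2 * b * c + r, (IsSumSq.mul_self _).add hp,
          (IsSumSq.mul_self _).add hq, ?_⟩
        rw [map_add, map_mul, hbc, h]
        simp only [map_add, map_mul, map_ofNat]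
        linear_combination (algebraMap M Ω c) ^ 2 * hs
    obtain ⟨p, q, r, hp, hq, h'⟩ := key G hG
    have hr : r = 0 := by
      by_contra hr
      refine hs0 ⟨(-1 - (p + a * q)) / r, ?_⟩
      have : algebraMap M Ω r ≠ 0 := by simpa using hr
      rw [map_div₀, div_eq_iff this]
      rw [h] at h'
      simp only [map_sub, map_neg, map_one]
      linear_combination h'
    have h1 : p + a * q = -1 := (algebraMap M Ω).injective (by
      rw [map_neg, map_one, ← h, h', hr]; simp)
    have hq0 : q ≠ 0 := by
      rintro rfl
      exact IsSemireal.not_isSumSq_neg_one M (by rw [← h1]; simpa using hp)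
    have : -a = (1 + p) * (q * (q⁻¹ * q⁻¹)) := by
      field_simp; linear_combination -h1
    rw [this]
    exact (IsSumSq.one.add hp).mul (hq.mul (IsSumSq.mul_self _))
  refine ⟨fun a => ?_, ?_⟩
  · by_contra! h
    have h1 := hsq a h.1
    have h2 := hsq (-a) h.2
    rw [neg_neg] at h2
    have ha : a ≠ 0 := by rintro rfl; exact h.1 ⟨0, by simp⟩
    refine IsSemireal.not_isSumSq_neg_one M ?_
    have : (-1 : M) = (-a * a) * (a⁻¹ * a⁻¹) := by field_simp
    rw [this]
    exact (h1.mul h2).mul (IsSumSq.mul_self _)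
  · intro f hf
    induction hn : f.natDegree using Nat.strong_induction_on generalizing f with
    | _ n ih =>
    have hf0 : f ≠ 0 := by rintro rfl; simp at hf
    by_cases hirr : Irreducible f
    · obtain ⟨x, hx⟩ := IsAlgClosed.exists_aeval_eq_zero Ω f (degree_pos_of_irreducible hirr).ne'
      have hint : IsIntegral M x := Algebra.IsIntegral.isIntegral x
      have hmd : (minpoly M x).natDegree = n := by
        rw [← hn]
        exact natDegree_eq_of_degree_eq (degree_eq_degree_of_associated
          ((minpoly.irreducible hint).associated_of_dvd hirr (minpoly.dvd M x hx)))
      by_cases hxM : x ∈ (algebraMap M Ω).range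
      · obtain ⟨r, rfl⟩ := hxM
        refine ⟨r, (algebraMap M Ω).injective ?_⟩
        rw [map_zero, ← hx, aeval_algebraMap_apply, coe_aeval_eq_eval]
      · obtain ⟨G, hG, hGd, hGx⟩ := hadj x hxM
        rw [hmd] at hGd
        have hdvd : f ∣ 1 + G := by
          refine ((minpoly.irreducible hint).associated_of_dvd hirr
            (minpoly.dvd M x hx)).symm.dvd.trans (minpoly.dvd M x ?_)
          rw [map_add, hGx, map_one, add_neg_cancel]
        obtain ⟨h, hh⟩ := hdvd
        have hne : 1 + G ≠ 0 := by
          intro h0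
          have h1 : G = C (-1) := by rw [C_neg, C_1]; linear_combination h0
          have := hG.even_natDegree_and_leadingCoeff.2
          rw [h1, leadingCoeff_C] at this
          exact IsSemireal.not_isSumSq_neg_one M this
        have hh0 : h ≠ 0 := by rintro rfl; exact hne (by rw [hh, mul_zero])
        have hev := ((IsSumSq.one).add hG).even_natDegree_and_leadingCoeff.1
        have hle : (1 + G).natDegree ≤ 2 * (n - 1) :=
          (natDegree_add_le _ _).trans (max_le (by simp) hGd)
        rw [hh, natDegree_mul hf0 hh0, hn] at hev hle
        rw [hn] at hf
        have hho : Odd h.natDegree := by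
          rcases Nat.even_or_odd h.natDegree with h' | h'
          · exact absurd hev (Nat.not_even_iff_odd.mpr (hf.add_even h'))
          · exact h'
        obtain ⟨r, hr⟩ := ih h.natDegree (by have := hf.pos; omega) hho rfl
        exfalso
        have h1 : eval r (1 + G) = 0 := by rw [hh, eval_mul, hr.eq_zero, mul_zero]
        rw [eval_add, eval_one] at h1
        exact IsSemireal.one_add_ne_zero (hG.map_ringHom (evalRingHom r)) h1
    · have hnu : ¬ IsUnit f := fun hu => by
        rw [natDegree_eq_zero_of_isUnit hu] at hf
        simp at hf
      have : ∃ g h : M[X], ¬ IsUnit g ∧ ¬ IsUnit h ∧ f = g * h := by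
        by_contra! hcon
        exact hirr ⟨hnu, fun {a b} hab => by
          by_contra! h'
          exact hcon a b h'.1 h'.2 hab⟩
      obtain ⟨g, h, hg, hh, rfl⟩ := this
      have hg0 := left_ne_zero_of_mul hf0
      have hh0 := right_ne_zero_of_mul hf0
      have hgd : 0 < g.natDegree := Nat.pos_of_ne_zero fun h0 =>
        hg (isUnit_iff_degree_eq_zero.mpr (by rw [degree_eq_natDegree hg0, h0]; rfl))
      have hhd : 0 < h.natDegree := Nat.pos_of_ne_zero fun h0 =>
        hh (isUnit_iff_degree_eq_zero.mpr (by rw [degree_eq_natDegree hh0, h0]; rfl))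
      rw [natDegree_mul hg0 hh0] at hf hn
      rcases Nat.even_or_odd g.natDegree with hge | hgo
      · have hho : Odd h.natDegree := by
          rcases Nat.even_or_odd h.natDegree with h' | h'
          · exact absurd (hge.add h') (Nat.not_even_iff_odd.mpr hf)
          · exact h'
        obtain ⟨r, hr⟩ := ih h.natDegree (by omega) hho rfl
        exact ⟨r, by rw [IsRoot, eval_mul, hr.eq_zero, mul_zero]⟩
      · obtain ⟨r, hr⟩ := ih g.natDegree (by omega) hgo rfl
        exact ⟨r, by rw [IsRoot, eval_mul, hr.eq_zero, zero_mul]⟩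

end RealClosure

/-- Every semireal field is contained in a real closed field. -/
theorem IsSemireal.exists_isRealClosed (F : Type*) [Field F] [IsSemireal F] :
    ∃ M : IntermediateField F (AlgebraicClosure F), IsRealClosed M := by
  let Ω := AlgebraicClosure F
  let S : Set (IntermediateField F Ω) := {M | IsSemireal M}
  have hbot : (⊥ : IntermediateField F Ω) ∈ S := by
    refine isSemireal_iff_not_isSumSq_neg_one.mpr fun h => ?_
    refine IsSemireal.not_isSumSq_neg_one F ?_
    simpa using h.map_ringHom (botEquiv F Ω : (⊥ : IntermediateField F Ω) →+* F)
  obtain ⟨M, -, hM⟩ := zorn_le_nonempty₀ S (fun c hcS hc y hy => by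
    have hdir : DirectedOn (· ≤ ·) c := hc.directedOn
    have hcoe : ∀ z : Ω, z ∈ sSup c ↔ ∃ N ∈ c, z ∈ N := by
      intro z
      have : Nonempty c := ⟨⟨y, hy⟩⟩
      rw [sSup_eq_iSup', ← SetLike.mem_coe, coe_iSup_of_directed hdir.directed_val]
      simp
    refine ⟨sSup c, ?_, fun z hz => le_sSup hz⟩
    refine isSemireal_iff_not_isSumSq_neg_one.mpr fun h => ?_
    -- A sum of squares involves finitely many elements, so it already occurs in one member of the
    -- chain.
    have key : ∀ z : ↥(sSup c), IsSumSq z → ∃ N ∈ c, ∃ w : N, IsSumSq w ∧ (w : Ω) = z := by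
      intro z hz
      induction hz with
      | zero => exact ⟨y, hy, 0, .zero, rfl⟩
      | @sq_add a s _ ih =>
        obtain ⟨N, hN, w, hw, hws⟩ := ih
        obtain ⟨N', hN', haN⟩ := (hcoe a).mp a.2
        obtain ⟨P, hP, h1, h2⟩ := hdir N hN N' hN'
        refine ⟨P, hP, ⟨a, h2 haN⟩ * ⟨a, h2 haN⟩ + inclusion h1 w,
          (IsSumSq.mul_self _).add (hw.map_ringHom (inclusion h1 : N →+* P)), ?_⟩
        have : ((inclusion h1 w : P) : Ω) = s := hws
        change (a : Ω) * a + ((inclusion h1 w : P) : Ω) = a * a + s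
        rw [this]
    obtain ⟨N, hN, w, hw, hw1⟩ := key _ h
    have : w = -1 := Subtype.ext hw1
    have hNS : IsSemireal N := hcS hN
    exact IsSemireal.not_isSumSq_neg_one N (this ▸ hw)) ⊥ hbot
  have hMS : IsSemireal M := hM.prop
  refine ⟨M, IsRealClosed.of_maximal (Ω := Ω) fun x hx => ?_⟩
  have h1 : (M⟮x⟯.restrictScalars F : IntermediateField F Ω) ∈ S := hx
  have h2 : M ≤ M⟮x⟯.restrictScalars F := fun m hm => M⟮x⟯.algebraMap_mem ⟨m, hm⟩
  have h3 := hM.le_of_ge h1 h2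
  exact ⟨⟨x, h3 (mem_adjoin_simple_self M x)⟩, rfl⟩

end

section

open Polynomial IntermediateField

/-! ### The trace form of a monic polynomial -/

namespace Polynomial

section CommRing

variable {A : Type*} [CommRing A]

/-- The functional `f ↦ ∑ f(z)`, the sum over the roots `z` of the monic polynomial `q`. -/
noncomputable def rootSum (q : A[X]) : A[X] →ₗ[A] A :=
  lcoeff A (q.natDegree - 1) ∘ₗ modByMonicHom q ∘ₗ LinearMap.mulLeft A (derivative q)

theorem rootSum_apply (q f : A[X]) :
    rootSum q f = ((derivative q * f) %ₘ q).coeff (q.natDegree - 1) := rfl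

/-- The functional uses only division by a monic polynomial, never the roots, so it commutes with
specialization of the coefficients. -/
theorem rootSum_map {B : Type*} [CommRing B] [Nontrivial B] (φ : A →+* B) {q : A[X]}
    (hq : q.Monic) (f : A[X]) : rootSum (q.map φ) (f.map φ) = φ (rootSum q f) := by
  rw [rootSum_apply, rootSum_apply, derivative_map, ← Polynomial.map_mul, ← map_modByMonic φ hq,
    coeff_map, hq.natDegree_map]

/-- Induction on the roots: modulo `(X - z) q`, the product `q f` is `f(z) q`, whose top coefficient
is the new summand, while `(X - z) q' f` reproduces the old sum. -/
theorem rootSum_prod_X_sub_C [IsDomain A] (s : Multiset A) (f : A[X]) :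
    rootSum (s.map fun z => X - C z).prod f = (s.map fun z => f.eval z).sum := by
  induction s using Multiset.induction with
  | empty => simp [rootSum_apply]
  | cons z s ih =>
    rw [Multiset.map_cons, Multiset.prod_cons, Multiset.map_cons, Multiset.sum_cons, ← ih]
    set q := (s.map fun z => X - C z).prod with hqdef
    have hq : q.Monic := monic_multisetProd_X_sub_C s
    have hz : (X - C z : A[X]).Monic := monic_X_sub_C z
    have hd : ((X - C z) * q).natDegree = q.natDegree + 1 := by
      rw [hz.natDegree_mul hq, natDegree_X_sub_C, add_comm]
    have hzq := hz.mul hq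
    have h1 : (q * f) %ₘ ((X - C z) * q) = C (f.eval z) * q := by
      refine (div_modByMonic_unique (f /ₘ (X - C z)) _ hzq ⟨?_, ?_⟩).2
      · have := modByMonic_add_div f (X - C z)
        rw [modByMonic_X_sub_C_eq_C_eval] at this
        linear_combination q * this
      · rw [degree_eq_natDegree hzq.ne_zero, hd]
        exact degree_le_natDegree.trans_lt
          (by exact_mod_cast Nat.lt_succ_of_le (natDegree_C_mul_le _ _))
    have h2 : ((X - C z) * derivative q * f) %ₘ ((X - C z) * q) =
        (X - C z) * ((derivative q * f) %ₘ q) := by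
      refine (div_modByMonic_unique ((derivative q * f) /ₘ q) _ hzq ⟨?_, ?_⟩).2
      · have := modByMonic_add_div (derivative q * f) q
        linear_combination (X - C z) * this
      · rw [degree_mul, degree_mul]
        have : (X - C z : A[X]).degree = 1 := degree_X_sub_C z
        rw [this]
        exact WithBot.add_lt_add_left (by simp) (degree_modByMonic_lt _ hq)
    have h3 : derivative ((X - C z) * q) * f = q * f + (X - C z) * derivative q * f := by
      rw [derivative_mul, derivative_X_sub_C]; ring
    rw [rootSum_apply, h3, add_modByMonic, h1, h2, hd, coeff_add, Nat.add_sub_cancel, coeff_C_mul,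
      hq.coeff_natDegree, mul_one, rootSum_apply]
    congr 1
    -- For `q = 1` the subtraction `q.natDegree - 1` is truncated, but the remainder modulo `1` is
    -- zero.
    rcases Nat.eq_zero_or_pos q.natDegree with h0 | h0
    · have : q = 1 := hq.natDegree_eq_zero.mp h0
      simp [this]
    · have hlt : ((derivative q * f) %ₘ q).natDegree < q.natDegree :=
        natDegree_modByMonic_lt _ hq (fun h => by rw [h] at h0; simp at h0)
      obtain ⟨n, hn⟩ := Nat.exists_eq_add_of_lt h0
      rw [zero_add] at hn
      rw [hn, Nat.add_sub_cancel, sub_mul, coeff_sub, coeff_X_mul, coeff_C_mul, ← hn,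
        coeff_eq_zero_of_natDegree_lt hlt, mul_zero, sub_zero]

end CommRing

section Field

variable {L : Type*} [Field L]

/-- Nondegeneracy of the trace form: by separability `p' f` has a nonzero remainder modulo `p`, and
a power of `X` shifts its leading coefficient into the position read by `rootSum`. -/
theorem exists_rootSum_mul_ne_zero {p : L[X]} (hp : p.Monic) (hsep : p.Separable) {f : L[X]}
    (hf : f ≠ 0) (hfd : f.degree < p.degree) :
    ∃ g : L[X], g.degree < p.degree ∧ rootSum p (f * g) ≠ 0 := by
  set h := (derivative p * f) %ₘ p with hh
  have hh0 : h ≠ 0 := by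
    intro h0
    have h1 : p ∣ derivative p * f := (modByMonic_eq_zero_iff_dvd hp).mp h0
    have h2 : p ∣ f := hsep.dvd_of_dvd_mul_left h1
    exact absurd (degree_le_of_dvd h2 hf) (not_le.mpr hfd)
  have hp1 : p ≠ 1 := fun h1 => by
    rw [h1, degree_one] at hfd
    exact hf (degree_eq_bot.mp (Nat.WithBot.lt_zero_iff.mp hfd))
  have hlt : h.natDegree < p.natDegree := natDegree_modByMonic_lt _ hp hp1
  refine ⟨X ^ (p.natDegree - 1 - h.natDegree), ?_, ?_⟩
  · rw [degree_X_pow, degree_eq_natDegree hp.ne_zero]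
    exact_mod_cast by omega
  · set m := p.natDegree - 1 - h.natDegree with hm
    have h1 : (derivative p * (f * X ^ m)) %ₘ p = h * X ^ m := by
      refine (div_modByMonic_unique (((derivative p * f) /ₘ p) * X ^ m) _ hp ⟨?_, ?_⟩).2
      · have := modByMonic_add_div (derivative p * f) p
        linear_combination X ^ m * this
      · rw [degree_mul, degree_X_pow, degree_eq_natDegree hh0, degree_eq_natDegree hp.ne_zero]
        exact_mod_cast by omega
    rw [rootSum_apply, h1, show p.natDegree - 1 = h.natDegree + m by omega, coeff_mul_X_pow]
    exact leadingCoeff_ne_zero.mpr hh0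

theorem exists_orthogonal_rootSum [NeZero (2 : L)] {p : L[X]} (hp : p.Monic)
    (hsep : p.Separable) : ∃ e : Fin p.natDegree → L[X],
      (∀ i j, i ≠ j → rootSum p (e i * e j) = 0) ∧ ∀ i, rootSum p (e i * e i) ≠ 0 := by
  let V := degreeLT L p.natDegree
  let B : LinearMap.BilinForm L V := LinearMap.mk₂ L (fun f g => rootSum p ((f : L[X]) * g))
    (fun f f' g => by simp [add_mul]) (fun c f g => by simp)
    (fun f g g' => by simp [mul_add]) (fun c f g => by simp)
  have hB : ∀ f g : V, B f g = rootSum p ((f : L[X]) * g) := fun f g => rfl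
  have hsymm : LinearMap.IsSymm B := ⟨fun f g => by
    simp only [hB, RingHom.id_apply, mul_comm]⟩
  have : Invertible (2 : L) := invertibleOfNonzero two_ne_zero
  have : FiniteDimensional L V := (degreeLTEquiv L p.natDegree).symm.finiteDimensional
  have hfr : Module.finrank L V = p.natDegree := by
    rw [(degreeLTEquiv L p.natDegree).finrank_eq]; simp
  obtain ⟨v, hv⟩ := LinearMap.BilinForm.exists_orthogonal_basis hsymm
  have hmem : ∀ g : L[X], g.degree < p.degree ↔ g ∈ V := fun g => by
    rw [mem_degreeLT, degree_eq_natDegree hp.ne_zero]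
  have hnd : LinearMap.SeparatingLeft B := by
    intro f hf
    by_contra hf0
    obtain ⟨g, hg, hfg⟩ := exists_rootSum_mul_ne_zero hp hsep (f := f)
      (by simpa using hf0) ((hmem _).mpr f.2)
    exact hfg (hf ⟨g, (hmem g).mp hg⟩)
  let σ := finCongr hfr.symm
  refine ⟨fun i => (v (σ i) : L[X]), fun i j hij => ?_, fun i => ?_⟩
  · exact hv (fun h => hij (σ.injective h))
  · exact hv.not_isOrtho_basis_self_of_separatingLeft hnd (σ i)

/-- Clearing denominators only rescales the form by nonzero factors. A diagonalizing family with
coefficients in `A` can be specialized. -/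
theorem exists_orthogonal_rootSum_of_isFractionRing (L : Type*) [Field L] [NeZero (2 : L)]
    {A : Type*} [CommRing A] [IsDomain A] [Algebra A L] [IsFractionRing A L] {p : A[X]}
    (hp : p.Monic) (hsep : (p.map (algebraMap A L)).Separable) :
    ∃ e : Fin p.natDegree → A[X],
      (∀ i j, i ≠ j → rootSum p (e i * e j) = 0) ∧ ∀ i, rootSum p (e i * e i) ≠ 0 := by
  obtain ⟨v, hv0, hv1⟩ := exists_orthogonal_rootSum (hp.map (algebraMap A L)) hsep
  let σ := finCongr (hp.natDegree_map (algebraMap A L)).symm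
  choose b hb hbv using fun i => IsLocalization.integerNormalization_spec (nonZeroDivisors A) (v i)
  have key : ∀ i j, algebraMap A L (rootSum p
      (IsLocalization.integerNormalization (nonZeroDivisors A) (v i) *
        IsLocalization.integerNormalization (nonZeroDivisors A) (v j))) =
      algebraMap A L (b i * b j) * rootSum (p.map (algebraMap A L)) (v i * v j) := fun i j => by
    rw [← rootSum_map _ hp, Polynomial.map_mul, hbv, hbv, ← algebraMap_smul L (b i),
      ← algebraMap_smul L (b j), smul_mul_smul_comm, map_smul, ← map_mul, smul_eq_mul]
  have hinj := IsFractionRing.injective A L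
  refine ⟨fun i => IsLocalization.integerNormalization (nonZeroDivisors A) (v (σ i)),
    fun i j hij => hinj ?_, fun i h => ?_⟩
  · rw [key, hv0 _ _ (fun h => hij (σ.injective h)), mul_zero, map_zero]
  · have h1 := key (σ i) (σ i)
    rw [h, map_zero] at h1
    refine mul_ne_zero ?_ (hv1 (σ i)) h1.symm
    rw [map_ne_zero_iff _ hinj]
    exact mul_ne_zero (nonZeroDivisors.ne_zero (hb _)) (nonZeroDivisors.ne_zero (hb _))

end Field

end Polynomial

end

section

open Polynomial IntermediateField

/-! ### Sign conditions on the trace form over a real closed field -/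

namespace IsRealClosed

theorem _root_.Polynomial.rootSum_sum_smul {R : Type*} [CommRing R] {ι : Type*} [Fintype ι] {q : R[X]} {e : ι → R[X]}
    (horth : ∀ i j, i ≠ j → rootSum q (e i * e j) = 0) (c : ι → R) :
    rootSum q ((∑ i, c i • e i) * ∑ i, c i • e i) = ∑ i, c i * c i * rootSum q (e i * e i) := by
  rw [Finset.sum_mul_sum, map_sum]
  refine Finset.sum_congr rfl fun i _ => ?_
  rw [map_sum, Finset.sum_eq_single i]
  · rw [smul_mul_smul_comm, map_smul, smul_eq_mul]
  · intro j _ hj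
    rw [smul_mul_smul_comm, map_smul, horth i j hj.symm, smul_zero]
  · simp

variable {R : Type*} [Field R] [IsRealClosed R]

theorem rootSum_eq_sum_aroots {q : R[X]} (hq : q.Monic) (f : R[X]) :
    algebraMap R (Cx R) (rootSum q f) = ((q.aroots (Cx R)).map fun z => aeval z f).sum := by
  have hsp := IsAlgClosed.splits (q.map (algebraMap R (Cx R)))
  have h := hsp.eq_prod_roots_of_monic (hq.map _)
  rw [← rootSum_map _ hq, h, rootSum_prod_X_sub_C, ← aroots_def]
  simp only [eval_map_algebraMap]

theorem aeval_star (f : R[X]) (z : Cx R) : aeval (star z) f = star (aeval z f) := by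
  induction f using Polynomial.induction_on' with
  | add p q hp hq => rw [map_add, map_add, hp, hq, star_add]
  | monomial n a =>
    rw [aeval_monomial, aeval_monomial, star_mul', star_pow]
    congr 1
    ext <;> simp

/-- Real part of the sum over the complex roots; the signature estimates below rest on the
difference `Re² - Im²`. -/
theorem rootSum_mul_self {q : R[X]} (hq : q.Monic) (f : R[X]) :
    rootSum q (f * f) = ((q.aroots (Cx R)).map fun z =>
      (aeval z f).re * (aeval z f).re - (aeval z f).im * (aeval z f).im).sum := by
  have h := congrArg (QuadraticAlgebra.reₗ (-1 : R) 0) (rootSum_eq_sum_aroots hq (f * f))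
  rw [map_multiset_sum, Multiset.map_map] at h
  refine Eq.trans ?_ (h.trans ?_)
  · simp
  · congr 1
    refine Multiset.map_congr rfl fun z _ => ?_
    simp [sub_eq_add_neg]

variable [LinearOrder R]

/-- The roots of `q` in the open upper half plane. -/
noncomputable def upperRoots (q : R[X]) : Finset (Cx R) := by
  classical exact (q.aroots (Cx R)).toFinset.filter fun z => 0 < z.im

theorem mem_upperRoots {q : R[X]} (hq : q.Monic) {z : Cx R} :
    z ∈ upperRoots q ↔ aeval z q = 0 ∧ 0 < z.im := by
  classical
  rw [upperRoots, Finset.mem_filter, Multiset.mem_toFinset, mem_aroots]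
  simp [hq.ne_zero]

/-- There are fewer linear conditions than unknowns. With `ℓ` the real or imaginary part,
conjugation extends the vanishing to all nonreal roots. -/
theorem exists_sum_smul_upperRoots {ι : Type*} [Fintype ι] (e : ι → R[X]) (q : R[X])
    (ℓ : Cx R →ₗ[R] R) (hm : (upperRoots q).card < Fintype.card ι) :
    ∃ c : ι → R, c ≠ 0 ∧ ∀ z ∈ upperRoots q, ℓ (aeval z (∑ i, c i • e i)) = 0 := by
  let F : (ι → R) →ₗ[R] (upperRoots q → R) :=
    LinearMap.pi fun z => ℓ ∘ₗ (aeval (z : Cx R)).toLinearMap ∘ₗ Fintype.linearCombination R e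
  have hker : LinearMap.ker F ≠ ⊥ := LinearMap.ker_ne_bot_of_finrank_lt (by simpa using hm)
  obtain ⟨c, hc, hc0⟩ := (Submodule.ne_bot_iff _).mp hker
  refine ⟨c, hc0, fun z hz => ?_⟩
  have := congrFun (LinearMap.mem_ker.mp hc) ⟨z, hz⟩
  simpa [F, Fintype.linearCombination_apply] using this

variable [IsStrictOrderedRing R]

theorem two_mul_card_upperRoots_add_le {q : R[X]} (hq : q.Monic) :
    2 * (upperRoots q).card + q.roots.toFinset.card ≤ q.natDegree := by
  classical
  let U := upperRoots q
  let U' := U.image star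
  let V := q.roots.toFinset.image (algebraMap R (Cx R))
  have hsub : (U ∪ U') ∪ V ⊆ (q.aroots (Cx R)).toFinset := by
    intro z hz
    rw [Multiset.mem_toFinset, mem_aroots]
    refine ⟨hq.ne_zero, ?_⟩
    rcases Finset.mem_union.mp hz with hz | hz
    · rcases Finset.mem_union.mp hz with hz | hz
      · exact ((mem_upperRoots hq).mp hz).1
      · obtain ⟨w, hw, rfl⟩ := Finset.mem_image.mp hz
        rw [aeval_star, ((mem_upperRoots hq).mp hw).1, star_zero]
    · obtain ⟨w, hw, rfl⟩ := Finset.mem_image.mp hz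
      rw [Multiset.mem_toFinset, mem_roots'] at hw
      rw [aeval_algebraMap_apply, coe_aeval_eq_eval, hw.2.eq_zero, map_zero]
  have hU : ∀ z ∈ U, 0 < z.im := fun z hz => ((mem_upperRoots hq).mp hz).2
  have hU' : ∀ z ∈ U', z.im < 0 := fun z hz => by
    obtain ⟨w, hw, rfl⟩ := Finset.mem_image.mp hz
    simpa using hU w hw
  have hV : ∀ z ∈ V, z.im = 0 := fun z hz => by
    obtain ⟨w, hw, rfl⟩ := Finset.mem_image.mp hz
    simp
  have hd1 : Disjoint U U' := Finset.disjoint_left.mpr fun z h h' =>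
    lt_asymm (hU z h) (hU' z h')
  have hd2 : Disjoint (U ∪ U') V := Finset.disjoint_left.mpr fun z h h' => by
    rcases Finset.mem_union.mp h with h | h
    · exact (hU z h).ne' (hV z h')
    · exact (hU' z h).ne (hV z h')
  have h1 := Finset.card_le_card hsub
  rw [Finset.card_union_of_disjoint hd2, Finset.card_union_of_disjoint hd1,
    Finset.card_image_of_injective _ star_injective,
    Finset.card_image_of_injective _ (algebraMap R (Cx R)).injective] at h1
  have h2 : (q.aroots (Cx R)).toFinset.card ≤ q.natDegree :=
    (Multiset.toFinset_card_le _).trans ((card_roots' _).trans natDegree_map_le)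
  change 2 * U.card + _ ≤ _
  omega

theorem mem_upperRoots_or {q : R[X]} (hq : q.Monic) {z : Cx R} (hz : aeval z q = 0) :
    z.im = 0 ∨ z ∈ upperRoots q ∨ star z ∈ upperRoots q := by
  rcases lt_trichotomy z.im 0 with h | h | h
  · right; right
    rw [mem_upperRoots hq, aeval_star, hz]
    simpa using h
  · exact Or.inl h
  · exact Or.inr (Or.inl ((mem_upperRoots hq).mpr ⟨hz, h⟩))

/-- A polynomial without roots has no large positive definite subspace for its trace form. -/
theorem two_mul_le_natDegree_of_forall_not_isRoot {ι : Type*} [Fintype ι] {q : R[X]} (hq : q.Monic)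
    (hroot : ∀ x, ¬ q.IsRoot x) {e : ι → R[X]}
    (horth : ∀ i j, i ≠ j → rootSum q (e i * e j) = 0)
    (hpos : ∀ i, 0 < rootSum q (e i * e i)) : 2 * Fintype.card ι ≤ q.natDegree := by
  refine le_trans ?_ ((Nat.le_add_right _ _).trans (two_mul_card_upperRoots_add_le hq))
  by_contra! hlt
  -- This combination has purely imaginary values at all roots, so the trace form is at most zero on
  -- it.
  obtain ⟨c, hc, hz⟩ := exists_sum_smul_upperRoots e q (QuadraticAlgebra.reₗ (-1 : R) 0)
    (by omega)
  have h1 := rootSum_sum_smul horth c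
  obtain ⟨i, hi⟩ := Function.ne_iff.mp hc
  have h2 : 0 < ∑ i, c i * c i * rootSum q (e i * e i) :=
    Finset.sum_pos' (fun j _ => mul_nonneg (mul_self_nonneg _) (hpos j).le)
      ⟨i, Finset.mem_univ _, mul_pos (mul_self_pos.mpr hi) (hpos i)⟩
  rw [← h1, rootSum_mul_self hq] at h2
  refine absurd h2 (not_lt.mpr ?_)
  refine (Multiset.sum_le_card_nsmul _ 0 fun y hy => ?_).trans (by simp)
  obtain ⟨z, hz', rfl⟩ := Multiset.mem_map.mp hy
  have hzq : aeval z q = 0 := (mem_aroots.mp hz').2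
  have hre : (aeval z (∑ i, c i • e i)).re = 0 := by
    rcases mem_upperRoots_or hq hzq with h | h | h
    · exfalso
      have : z = algebraMap R (Cx R) z.re := by ext <;> simp [h]
      rw [this, aeval_algebraMap_apply, coe_aeval_eq_eval] at hzq
      exact hroot z.re (by simpa using hzq)
    · exact hz z h
    · have := hz _ h
      rw [aeval_star] at this
      have h' : (star (aeval z (∑ i, c i • e i))).re = 0 := this
      simpa only [QuadraticAlgebra.re_star, zero_mul, add_zero] using h'
  rw [hre]
  nlinarith [mul_self_nonneg (aeval z (∑ i, c i • e i)).im]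

/-- A polynomial with a root has no large negative definite subspace for its trace form. -/
theorem two_mul_lt_natDegree_of_isRoot {ι : Type*} [Fintype ι] {q : R[X]} (hq : q.Monic) {x : R}
    (hroot : q.IsRoot x) {e : ι → R[X]}
    (horth : ∀ i j, i ≠ j → rootSum q (e i * e j) = 0)
    (hneg : ∀ i, rootSum q (e i * e i) < 0) : 2 * Fintype.card ι < q.natDegree := by
  have hcard : 0 < q.roots.toFinset.card :=
    Finset.card_pos.mpr ⟨x, by simpa [hq.ne_zero] using hroot⟩
  have hle := two_mul_card_upperRoots_add_le hq
  refine lt_of_le_of_lt (b := 2 * (upperRoots q).card) ?_ (by omega)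
  by_contra! hlt
  -- Real values at all roots make the form nonnegative here. The strict bound comes from the root
  -- `x`, which is not counted among the conjugate pairs.
  obtain ⟨c, hc, hz⟩ := exists_sum_smul_upperRoots e q (QuadraticAlgebra.imₗ (-1 : R) 0)
    (by omega)
  have h1 := rootSum_sum_smul horth c
  obtain ⟨i, hi⟩ := Function.ne_iff.mp hc
  have h2 : ∑ i, c i * c i * rootSum q (e i * e i) < 0 :=
    Finset.sum_neg' (fun j _ => mul_nonpos_of_nonneg_of_nonpos (mul_self_nonneg _) (hneg j).le)
      ⟨i, Finset.mem_univ _, mul_neg_of_pos_of_neg (mul_self_pos.mpr hi) (hneg i)⟩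
  rw [← h1, rootSum_mul_self hq] at h2
  refine absurd h2 (not_lt.mpr ?_)
  refine Multiset.sum_nonneg fun y hy => ?_
  obtain ⟨z, hz', rfl⟩ := Multiset.mem_map.mp hy
  have hzq : aeval z q = 0 := (mem_aroots.mp hz').2
  have him : (aeval z (∑ i, c i • e i)).im = 0 := by
    rcases mem_upperRoots_or hq hzq with h | h | h
    · have : z = algebraMap R (Cx R) z.re := by ext <;> simp [h]
      rw [this, aeval_algebraMap_apply, coe_aeval_eq_eval]
      simp
    · exact hz z h
    · have := hz _ h
      rw [aeval_star] at this
      exact neg_eq_zero.mp this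
  rw [him]
  nlinarith [mul_self_nonneg (aeval z (∑ i, c i • e i)).re]

end IsRealClosed

end

section

open Polynomial IntermediateField

/-! ### Specialization of algebraic functions of one variable -/

namespace IsRealClosed

section Sign

variable {k : Type*} [Field k] [IsRealClosed k] [LinearOrder k] [IsStrictOrderedRing k]
  {K : Type*} [Field K] [LinearOrder K] [IsStrictOrderedRing K] [Algebra k K]

variable (k K) in
theorem strictMono_algebraMap : StrictMono (algebraMap k K) := by
  refine (monotone_iff_forall_lt.mpr fun a b hab => ?_).strictMono_of_injective
    (algebraMap k K).injective
  have : IsSquare (b - a) := nonneg_iff_isSquare.mp (by linarith)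
  have := (this.map (algebraMap k K)).nonneg
  rw [map_sub] at this
  linarith

theorem sign_algebraMap (u : k) : SignType.sign (algebraMap k K u) = SignType.sign u := by
  have h := strictMono_algebraMap k K
  rcases lt_trichotomy u 0 with hu | rfl | hu
  · have := h hu
    rw [map_zero] at this
    rw [sign_neg hu, sign_neg this]
  · simp
  · have := h hu
    rw [map_zero] at this
    rw [sign_pos hu, sign_pos this]

/-- `Z` collects the roots of the linear factors of `d`. The quadratic factors have constant sign,
so only the position relative to `Z` matters. -/
theorem exists_finset_sign_eval_eq {d : k[X]} (hd : d ≠ 0) : ∃ Z : Finset k, ∀ (a : k) (t : K),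
    (∀ z ∈ Z, z < a ∧ algebraMap k K z < t ∨ a < z ∧ t < algebraMap k K z) →
      SignType.sign (d.eval a) = SignType.sign (aeval t d) := by
  classical
  induction d using WfDvdMonoid.induction_on_irreducible with
  | zero => exact absurd rfl hd
  | unit u hu =>
    refine ⟨∅, fun a t _ => ?_⟩
    obtain ⟨c, -, rfl⟩ := Polynomial.isUnit_iff.mp hu
    rw [eval_C, aeval_C, sign_algebraMap]
  | mul d p hd0 hp ih =>
    obtain ⟨Z, hZ⟩ := ih hd0
    rcases eq_linear_or_quadratic_of_irreducible hp with ⟨u, r, hu, rfl⟩ | ⟨u, b, c, hu, hc, rfl⟩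
    · refine ⟨insert r Z, fun a t h => ?_⟩
      rw [eval_mul, map_mul (aeval t), sign_mul, sign_mul, hZ a t fun z hz => h z (Finset.mem_insert_of_mem hz)]
      congr 1
      simp only [eval_mul, eval_C, eval_sub, eval_X, map_mul, aeval_C, map_sub, aeval_X, sign_mul,
        sign_algebraMap]
      congr 1
      rcases h r (Finset.mem_insert_self _ _) with ⟨h1, h2⟩ | ⟨h1, h2⟩
      · rw [sign_pos (sub_pos.mpr h1), sign_pos (sub_pos.mpr h2)]
      · rw [sign_neg (sub_neg.mpr h1), sign_neg (sub_neg.mpr h2)]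
    · refine ⟨Z, fun a t h => ?_⟩
      rw [eval_mul, map_mul (aeval t), sign_mul, sign_mul, hZ a t h]
      congr 1
      simp only [eval_mul, eval_C, eval_sub, eval_X, map_mul, aeval_C, map_sub, aeval_X, sign_mul,
        sign_algebraMap, eval_add, eval_pow, map_add, map_pow]
      congr 1
      have hc' : algebraMap k K c ≠ 0 := by simpa using hc
      rw [sign_pos (by positivity), sign_pos (by positivity)]

/-- `t` cuts the finite set of relevant roots into a lower and an upper part, and `a` is any element
of `k` between them. -/
theorem exists_sign_eval_eq {t : K} (ht : t ∉ (algebraMap k K).range) (D : Finset k[X])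
    (hD : ∀ d ∈ D, d ≠ 0) :
    ∃ a : k, ∀ d ∈ D, SignType.sign (d.eval a) = SignType.sign (aeval t d) := by
  classical
  choose! Z hZ using fun (d : k[X]) (hd : d ≠ 0) => exists_finset_sign_eval_eq (K := K) hd
  let W := D.biUnion Z
  have hmono := strictMono_algebraMap k K
  obtain ⟨a, hlo, hhi⟩ := Order.exists_between_finsets
    (W.filter fun z => algebraMap k K z < t) (W.filter fun z => t < algebraMap k K z)
    (fun x hx y hy => hmono.lt_iff_lt.mp
      ((Finset.mem_filter.mp hx).2.trans (Finset.mem_filter.mp hy).2))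
  refine ⟨a, fun d hd => hZ d (hD d hd) a t fun z hz => ?_⟩
  have hzW : z ∈ W := Finset.mem_biUnion.mpr ⟨d, hd, hz⟩
  rcases lt_trichotomy (algebraMap k K z) t with h | h | h
  · exact Or.inl ⟨hlo z (Finset.mem_filter.mpr ⟨hzW, h⟩), h⟩
  · exact absurd ⟨z, h⟩ ht
  · exact Or.inr ⟨hhi z (Finset.mem_filter.mpr ⟨hzW, h⟩), h⟩

variable [IsRealClosed K]

/-- A root in `K` of a polynomial over `k[t]` specializes to roots in `k`. -/
theorem exists_isRoot_map_evalRingHom {t : K} (ht : t ∉ (algebraMap k K).range)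
    {p : k[X][X]} (hp : p.Monic)
    (hsep : (p.map (algebraMap k[X] (FractionRing k[X]))).Separable) {θ : K}
    (hθ : (p.map (aeval t : k[X] →ₐ[k] K).toRingHom).IsRoot θ) {h : k[X]} (hh : h ≠ 0) :
    ∃ a r : k, h.eval a ≠ 0 ∧ (p.map (evalRingHom a)).IsRoot r := by
  classical
  obtain ⟨e, he0, he1⟩ := exists_orthogonal_rootSum_of_isFractionRing (FractionRing k[X]) hp hsep
  -- The diagonal entries of the trace form get the same signs at `a` as at `t`; including `h`
  -- ensures `h(a) ≠ 0`.
  obtain ⟨a, ha⟩ := exists_sign_eval_eq ht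
    (insert h (Finset.univ.image fun i => rootSum p (e i * e i))) (by
      intro d hd
      rcases Finset.mem_insert.mp hd with rfl | hd
      · exact hh
      · obtain ⟨i, -, rfl⟩ := Finset.mem_image.mp hd
        exact he1 i)
  have hinj : Function.Injective (aeval t : k[X] →ₐ[k] K) := by
    rw [← transcendental_iff_injective]
    exact fun halg => ht (mem_range_of_isAlgebraic halg)
  have hne : ∀ d : k[X], d ≠ 0 → SignType.sign (d.eval a) = SignType.sign (aeval t d) →
      d.eval a ≠ 0 := by
    intro d hd h1 h2
    rw [h2, sign_zero] at h1
    exact hd (hinj ((sign_eq_zero_iff.mp h1.symm).trans (map_zero _).symm))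
  have hsign : ∀ i, SignType.sign ((rootSum p (e i * e i)).eval a) =
      SignType.sign (aeval t (rootSum p (e i * e i))) := fun i => ha _ (by simp)
  by_contra! hcon
  have hnr : ∀ x, ¬ (p.map (evalRingHom a)).IsRoot x := fun x =>
    hcon a x (hne h hh (ha h (by simp)))
  let ψ := (aeval t : k[X] →ₐ[k] K).toRingHom
  -- Without a root at `a`, `2|P| ≤ deg p`; the root at `t` gives `2|N| < deg p`. This contradicts
  -- `|P| + |N| = deg p`.
  let P := {i // 0 < (rootSum p (e i * e i)).eval a}
  let N := {i // ¬ 0 < (rootSum p (e i * e i)).eval a}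
  have hcard : Fintype.card P + Fintype.card N = p.natDegree := by
    have := Fintype.card_subtype_compl (fun i => 0 < (rootSum p (e i * e i)).eval a)
    have h2 := Fintype.card_subtype_le (fun i => 0 < (rootSum p (e i * e i)).eval a)
    rw [Fintype.card_fin] at this h2
    change Fintype.card P ≤ _ at h2
    change Fintype.card N = _ - Fintype.card P at this
    omega
  have h1 := two_mul_le_natDegree_of_forall_not_isRoot (ι := P) (hp.map (evalRingHom a)) hnr
    (e := fun i => (e i).map (evalRingHom a))
    (fun i j hij => by
      rw [← Polynomial.map_mul, rootSum_map _ hp, he0 _ _ (fun h => hij (Subtype.ext h)), map_zero])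
    (fun i => by
      rw [← Polynomial.map_mul, rootSum_map _ hp]
      exact i.2)
  have h2 := two_mul_lt_natDegree_of_isRoot (ι := N) (hp.map ψ) hθ
    (e := fun i => (e i).map ψ)
    (fun i j hij => by
      rw [← Polynomial.map_mul, rootSum_map _ hp, he0 _ _ (fun h => hij (Subtype.ext h)), map_zero])
    (fun i => by
      rw [← Polynomial.map_mul, rootSum_map _ hp]
      have h3 := hne _ (he1 i) (hsign i)
      have h4 := hsign i
      rw [sign_neg (lt_of_le_of_ne (not_lt.mp i.2) h3)] at h4
      exact sign_eq_neg_one_iff.mp h4.symm)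
  rw [hp.natDegree_map] at h1 h2
  omega

end Sign

end IsRealClosed

end

section

open Polynomial IntermediateField

/-! ### The Artin–Lang theorem -/

namespace IsRealClosed

universe u v

/-- Points of algebraic functions of one variable specialize to points over the constants. -/
theorem exists_specialization_of_isAlgebraic {k : Type u} {K : Type v} [Field k] [IsRealClosed k]
    [Field K] [IsRealClosed K] [Algebra k K] [Algebra k[X] K] [IsScalarTower k k[X] K]
    [Algebra (FractionRing k[X]) K] [IsScalarTower k[X] (FractionRing k[X]) K]
    [Algebra.IsAlgebraic (FractionRing k[X]) K] {ι : Type*} [Finite ι] (y : ι → K) :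
    ∃ b : ι → k, ∀ F : MvPolynomial ι k, MvPolynomial.aeval y F = 0 →
      MvPolynomial.aeval b F = 0 := by
  classical
  have := Fintype.ofFinite ι
  let L := FractionRing k[X]
  let t : K := algebraMap k[X] K X
  have hinj : Function.Injective (algebraMap k[X] K) := by
    rw [IsScalarTower.algebraMap_eq k[X] L K]
    exact (algebraMap L K).injective.comp (IsFractionRing.injective k[X] L)
  have : FaithfulSMul k[X] K := (faithfulSMul_iff_algebraMap_injective _ _).mpr hinj
  have ht' : (aeval t : k[X] →ₐ[k] K) = IsScalarTower.toAlgHom k k[X] K := by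
    ext; simp [t]
  have htφ : (aeval t : k[X] →ₐ[k] K).toRingHom = algebraMap k[X] K := by
    rw [ht']; rfl
  have ht : t ∉ (algebraMap k K).range := by
    rintro ⟨c, hc⟩
    have : (C c : k[X]) = X := hinj
      ((IsScalarTower.algebraMap_apply k k[X] K c).symm.trans hc)
    exact X_ne_C c this.symm
  -- a primitive element, integral over `k[X]`
  let E : IntermediateField L K := adjoin L (Set.range y)
  have : FiniteDimensional L E := finiteDimensional_adjoin
    fun z _ => Algebra.IsIntegral.isIntegral z
  have : CharZero L := charZero_of_injective_algebraMap (algebraMap k L).injective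
  obtain ⟨α, hα⟩ := Field.exists_primitive_element L E
  have hyα : ∀ j, ∃ g : L[X], aeval (α : K) g = y j := by
    intro j
    have h1 : (⟨y j, subset_adjoin _ _ ⟨j, rfl⟩⟩ : E) ∈ L⟮α⟯.toSubalgebra := by
      change _ ∈ L⟮α⟯
      rw [hα]; exact mem_top
    rw [adjoin_simple_toSubalgebra_of_isAlgebraic (Algebra.IsAlgebraic.isAlgebraic α),
      Algebra.adjoin_singleton_eq_range_aeval] at h1
    obtain ⟨g, hg⟩ := h1
    refine ⟨g, ?_⟩
    have := congrArg (algebraMap E K) hg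
    exact (aeval_algebraMap_apply K α g).trans this
  obtain ⟨m, hm⟩ := IsIntegral.exists_multiple_integral_of_isLocalization
    (nonZeroDivisors k[X]) (α : K) (Algebra.IsIntegral.isIntegral (R := L) (α : K))
  set θ : K := m • (α : K) with hθdef
  have hm0 : (algebraMap k[X] L m) ≠ 0 := by
    rw [map_ne_zero_iff _ (IsFractionRing.injective k[X] L)]
    exact nonZeroDivisors.ne_zero m.2
  -- Each coordinate is `g(θ) / h(t)`; the specialization must avoid the zeros of these
  -- denominators.
  have hyθ : ∀ j, ∃ (g : k[X][X]) (h : k[X]), h ≠ 0 ∧ aeval θ g = algebraMap k[X] K h * y j := by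
    intro j
    obtain ⟨g, hg⟩ := hyα j
    let g' : L[X] := g.comp (C (algebraMap k[X] L m)⁻¹ * X)
    have hg' : aeval θ g' = y j := by
      rw [← hg, aeval_comp]
      congr 2
      rw [map_mul, aeval_C, aeval_X, hθdef, Submonoid.smul_def, Algebra.smul_def,
        IsScalarTower.algebraMap_apply k[X] L K, ← mul_assoc, ← map_mul, inv_mul_cancel₀ hm0,
        map_one, one_mul]
    obtain ⟨b, hb, hb'⟩ := IsLocalization.integerNormalization_spec (nonZeroDivisors k[X]) g'
    refine ⟨IsLocalization.integerNormalization (nonZeroDivisors k[X]) g', b,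
      nonZeroDivisors.ne_zero hb, ?_⟩
    rw [← aeval_map_algebraMap L, hb', ← algebraMap_smul L b, map_smul, hg', Algebra.smul_def,
      ← IsScalarTower.algebraMap_apply]
  choose g h hh hgh using hyθ
  -- specialization of the minimal polynomial
  let p := minpoly k[X] θ
  have hp : p.Monic := minpoly.monic hm
  have hpL : minpoly L θ = p.map (algebraMap k[X] L) :=
    minpoly.isIntegrallyClosed_eq_field_fractions' L hm
  have hsep : (p.map (algebraMap k[X] L)).Separable := by
    rw [← hpL]
    exact (minpoly.irreducible (Algebra.IsIntegral.isIntegral θ)).separable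
  let := linearOrder k
  have := isStrictOrderedRing (k := k)
  let := linearOrder K
  have := isStrictOrderedRing (k := K)
  obtain ⟨a, r, ha, hr⟩ := exists_isRoot_map_evalRingHom ht hp hsep (θ := θ) (by
      rw [htφ, IsRoot, eval_map_algebraMap]
      exact minpoly.aeval _ _) (h := ∏ j, h j) (Finset.prod_ne_zero_iff.mpr fun j _ => hh j)
  have haj : ∀ j, (h j).eval a ≠ 0 := by
    rw [eval_prod] at ha
    exact fun j => Finset.prod_ne_zero_iff.mp ha j (Finset.mem_univ j)
  -- `αh` evaluates at `(t, θ)` and `βh` at `(a, r)`. The kernel of `αh` is generated by `p`, which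
  -- `βh` kills.
  let αh : k[X][X] →+* K := (aeval θ : k[X][X] →ₐ[k[X]] K).toRingHom
  let βh : k[X][X] →+* k := eval₂RingHom (evalRingHom a) r
  have hker : ∀ s, αh s = 0 → βh s = 0 := by
    intro s hs
    obtain ⟨s', rfl⟩ := minpoly.isIntegrallyClosed_dvd hm (p := s) hs
    have : βh p = 0 := by
      rw [IsRoot, eval_map] at hr
      exact hr
    rw [map_mul, this, zero_mul]
  have : (RingHom.ker βh).IsPrime := RingHom.ker_isPrime βh
  -- In this localization the denominators are invertible and both evaluations extend, so the `y j`
  -- lift to `Y j` and can be specialized.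
  let S := (RingHom.ker βh).primeCompl
  have hS : ∀ s : S, βh s ≠ 0 := fun s h => s.2 (RingHom.mem_ker.mpr h)
  let Loc := Localization S
  let αl : Loc →+* K := IsLocalization.lift (M := S) (S := Loc) (g := αh)
    fun s => isUnit_iff_ne_zero.mpr fun h0 => hS s (hker _ h0)
  let βl : Loc →+* k := IsLocalization.lift (M := S) (S := Loc) (g := βh)
    fun s => isUnit_iff_ne_zero.mpr (hS s)
  have hkl : ∀ z, αl z = 0 → βl z = 0 := by
    intro z hz
    obtain ⟨d, s, rfl⟩ := IsLocalization.exists_mk'_eq S z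
    have h1 : αl (algebraMap k[X][X] Loc d) = 0 := by
      rw [← IsLocalization.mk'_spec Loc d s, map_mul, hz, zero_mul]
    rw [IsLocalization.lift_eq] at h1
    have h2 : βl (IsLocalization.mk' Loc d s) * βl (algebraMap k[X][X] Loc s) = 0 := by
      rw [← map_mul, IsLocalization.mk'_spec, IsLocalization.lift_eq, hker d h1]
    rw [IsLocalization.lift_eq] at h2
    exact (mul_eq_zero.mp h2).resolve_right (hS s)
  have hhS : ∀ j, (C (h j) : k[X][X]) ∈ S := fun j hj => by
    have hj : βh (C (h j)) = 0 := RingHom.mem_ker.mp hj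
    exact haj j (by simpa [βh] using hj)
  let Y : ι → Loc := fun j => IsLocalization.mk' Loc (g j) (⟨C (h j), hhS j⟩ : S)
  have hY : ∀ j, αl (Y j) = y j := by
    intro j
    have h0 : algebraMap k[X] K (h j) ≠ 0 := by
      rw [map_ne_zero_iff _ hinj]; exact hh j
    have h1 : αl (Y j) * αl (algebraMap k[X][X] Loc (C (h j))) = αl (algebraMap k[X][X] Loc (g j)) := by
      rw [← map_mul]
      congr 1
      exact IsLocalization.mk'_spec Loc (g j) (⟨C (h j), hhS j⟩ : S)
    rw [IsLocalization.lift_eq, IsLocalization.lift_eq] at h1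
    have h2 : αh (g j) = algebraMap k[X] K (h j) * y j := hgh j
    have h3 : αh (C (h j)) = algebraMap k[X] K (h j) := aeval_C _ _
    rw [h2, h3, mul_comm] at h1
    exact mul_left_cancel₀ h0 h1
  let ι₀ : k →+* Loc := (algebraMap k[X][X] Loc).comp ((C : k[X] →+* _).comp (C : k →+* _))
  have hα0 : αl.comp ι₀ = algebraMap k K := by
    ext c
    change αl (algebraMap k[X][X] Loc (C (C c))) = _
    rw [IsLocalization.lift_eq]
    change aeval θ (C (C c) : k[X][X]) = _
    rw [aeval_C, IsScalarTower.algebraMap_apply k k[X] K]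
    rfl
  have hβ0 : βl.comp ι₀ = algebraMap k k := by
    ext c
    change βl (algebraMap k[X][X] Loc (C (C c))) = _
    rw [IsLocalization.lift_eq]
    simp [βh]
  refine ⟨fun j => βl (Y j), fun F hF => ?_⟩
  have h1 : αl (MvPolynomial.eval₂ ι₀ Y F) = 0 := by
    rw [MvPolynomial.hom_eval₂, hα0]
    have : (fun j => αl (Y j)) = y := funext hY
    exact (congrArg (fun z => MvPolynomial.eval₂ (algebraMap k K) z F) this).trans hF
  have h2 := hkl _ h1
  rw [MvPolynomial.hom_eval₂, hβ0] at h2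
  exact h2

/-- **Artin–Lang**: points over a real closed extension specialize to rational points, for
one variable more than is known over all real closed fields in the universe of the extension. -/
theorem exists_specialization_succ {n : ℕ}
    (ih : ∀ (k R : Type v) [Field k] [IsRealClosed k] [Field R] [IsRealClosed R] [Algebra k R]
      (x : Fin n → R), ∃ a : Fin n → k, ∀ F : MvPolynomial (Fin n) k,
        MvPolynomial.aeval x F = 0 → MvPolynomial.aeval a F = 0)
    {k : Type u} {R : Type v} [Field k] [IsRealClosed k] [Field R] [IsRealClosed R] [Algebra k R]
    (x : Fin (n + 1) → R) : ∃ a : Fin (n + 1) → k, ∀ F : MvPolynomial (Fin (n + 1)) k,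
      MvPolynomial.aeval x F = 0 → MvPolynomial.aeval a F = 0 := by
  -- specialize the last variables to an intermediate field containing the first one
  have key : ∀ {F : Type u} [Field F] [Algebra F R] (K : IntermediateField F R) [Algebra k K]
      [IsScalarTower k K R], (∀ z : R, IsAlgebraic K z → z ∈ K) → x 0 ∈ K →
      ∃ y : Fin (n + 1) → K, ∀ F : MvPolynomial (Fin (n + 1)) k,
        MvPolynomial.aeval x F = 0 → MvPolynomial.aeval y F = 0 := by
    intro F _ _ K _ _ hK hx
    have := of_forall_isAlgebraic_mem K hK
    obtain ⟨y, hy⟩ := ih K R (fun i => x i.succ)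
    refine ⟨Fin.cons ⟨x 0, hx⟩ y, fun G hG => ?_⟩
    let ψ : MvPolynomial (Fin (n + 1)) k →ₐ[k] MvPolynomial (Fin n) K :=
      MvPolynomial.aeval (Fin.cons (MvPolynomial.C ⟨x 0, hx⟩) MvPolynomial.X)
    have h1 : ((MvPolynomial.aeval fun i : Fin n => x i.succ).restrictScalars k).comp ψ =
        MvPolynomial.aeval x := by
      refine MvPolynomial.algHom_ext fun i => ?_
      refine Fin.cases ?_ (fun j => ?_) i
      · simp only [AlgHom.comp_apply, ψ, MvPolynomial.aeval_X, Fin.cons_zero,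
          AlgHom.restrictScalars_apply, MvPolynomial.aeval_C]
        rfl
      · simp [ψ]
    have h2 : ((MvPolynomial.aeval y).restrictScalars k).comp ψ =
        MvPolynomial.aeval (Fin.cons ⟨x 0, hx⟩ y : Fin (n + 1) → K) := by
      refine MvPolynomial.algHom_ext fun i => ?_
      refine Fin.cases ?_ (fun j => ?_) i
      · simp only [AlgHom.comp_apply, ψ, MvPolynomial.aeval_X, Fin.cons_zero,
          AlgHom.restrictScalars_apply, MvPolynomial.aeval_C]
        rfl
      · simp [ψ]
    rw [← h2]
    refine hy (ψ G) ?_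
    rw [← h1] at hG
    exact hG
  -- If the first coordinate is algebraic, it lies in `k`. Otherwise `K` is the relative algebraic
  -- closure of `k(x 0)` in `R`, and the one-variable case leads from `K` to `k`.
  by_cases ht : IsAlgebraic k (x 0)
  · obtain ⟨y, hy⟩ := key (⊥ : IntermediateField k R)
      (fun z hz => by
        have h1 : IsAlgebraic k z := by
          have : Algebra.IsAlgebraic k (⊥ : IntermediateField k R) := inferInstance
          exact hz.restrictScalars k
        obtain ⟨c, hc⟩ := mem_range_of_isAlgebraic h1
        exact mem_bot.mpr ⟨c, hc⟩)
      (by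
        obtain ⟨c, hc⟩ := mem_range_of_isAlgebraic ht
        exact mem_bot.mpr ⟨c, hc⟩)
    refine ⟨fun i => botEquiv k R (y i), fun G hG => ?_⟩
    have h1 := congrArg (botEquiv k R) (hy G hG)
    rw [map_zero] at h1
    exact (MvPolynomial.comp_aeval_apply (R := k) (f := y)
      (botEquiv k R : (⊥ : IntermediateField k R) →ₐ[k] k) G).symm.trans h1
  · let : Algebra k[X] R := (aeval (x 0) : k[X] →ₐ[k] R).toAlgebra
    have hinj : Function.Injective (algebraMap k[X] R) := transcendental_iff_injective.mp ht
    have : FaithfulSMul k[X] R := (faithfulSMul_iff_algebraMap_injective _ _).mpr hinj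
    have : IsScalarTower k k[X] R := .of_algebraMap_eq fun c => (aeval_C (x 0) c).symm
    let L := FractionRing k[X]
    let : Algebra L R := FractionRing.liftAlgebra k[X] R
    have : IsScalarTower k[X] L R := FractionRing.isScalarTower_liftAlgebra k[X] R
    have : IsScalarTower k L R := .of_algebraMap_eq fun c => by
      rw [IsScalarTower.algebraMap_apply k k[X] L, ← IsScalarTower.algebraMap_apply k[X] L R,
        ← IsScalarTower.algebraMap_apply k k[X] R]
    let K : IntermediateField L R := algebraicClosure L R
    have hK : ∀ z : R, IsAlgebraic K z → z ∈ K := fun z hz =>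
      mem_algebraicClosure_iff.mpr (hz.restrictScalars L)
    have hx : x 0 ∈ K := mem_algebraicClosure_iff.mpr (by
      have : x 0 = algebraMap L R (algebraMap k[X] L X) := by
        rw [← IsScalarTower.algebraMap_apply]
        exact (aeval_X (x 0)).symm
      rw [this]
      exact isAlgebraic_algebraMap _)
    let : Algebra k K := ((algebraMap L K).comp (algebraMap k L)).toAlgebra
    let : Algebra k[X] K := ((algebraMap L K).comp (algebraMap k[X] L)).toAlgebra
    have : IsScalarTower k K R := .of_algebraMap_eq fun c => IsScalarTower.algebraMap_apply k L R c
    have : IsScalarTower k k[X] K := .of_algebraMap_eq fun c =>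
      congrArg (algebraMap L K) (IsScalarTower.algebraMap_apply k k[X] L c)
    have : IsScalarTower k[X] L K := .of_algebraMap_eq fun c => rfl
    obtain ⟨y, hy⟩ := key K hK hx
    have := of_forall_isAlgebraic_mem K hK
    obtain ⟨b, hb⟩ := exists_specialization_of_isAlgebraic (k := k) y
    exact ⟨b, fun F hF => hb F (hy F hF)⟩

/-- The intermediate fields live in the universe of `R`, so the induction stays there;
`exists_specialization` moves `k` to another universe by one more step. -/
theorem exists_specialization_same_universe (n : ℕ) : ∀ (k R : Type v) [Field k] [IsRealClosed k]
    [Field R] [IsRealClosed R] [Algebra k R] (x : Fin n → R), ∃ a : Fin n → k,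
      ∀ F : MvPolynomial (Fin n) k, MvPolynomial.aeval x F = 0 → MvPolynomial.aeval a F = 0 := by
  induction n with
  | zero =>
    intro k R _ _ _ _ _ x
    refine ⟨Fin.elim0, fun F hF => ?_⟩
    obtain ⟨c, rfl⟩ := MvPolynomial.C_surjective (Fin 0) F
    rw [MvPolynomial.aeval_C] at hF ⊢
    simpa using hF
  | succ n ih => exact fun k R _ _ _ _ _ x => exists_specialization_succ ih x

/-- **Artin–Lang**: a point with coordinates in a real closed extension of a real closed field
`k` specializes to a point with coordinates in `k`. -/
theorem exists_specialization {n : ℕ} {k : Type u} {R : Type v} [Field k] [IsRealClosed k]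
    [Field R] [IsRealClosed R] [Algebra k R] (x : Fin n → R) : ∃ a : Fin n → k,
      ∀ F : MvPolynomial (Fin n) k, MvPolynomial.aeval x F = 0 → MvPolynomial.aeval a F = 0 := by
  cases n with
  | zero =>
    refine ⟨Fin.elim0, fun F hF => ?_⟩
    obtain ⟨c, rfl⟩ := MvPolynomial.C_surjective (Fin 0) F
    rw [MvPolynomial.aeval_C] at hF ⊢
    simpa using hF
  | succ n => exact exists_specialization_succ (exists_specialization_same_universe n) x

end IsRealClosed

end

section

open Polynomial IntermediateField

/-! ### The real Nullstellensatz -/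

section Support

variable {A : Type*} [CommRing A] [Invertible (2 : A)]

variable (A) in
/-- The ideal of all `x` such that `x` and `-x` are sums of squares. -/
def sumSqSupport : Ideal A where
  carrier := {x | IsSumSq x ∧ IsSumSq (-x)}
  zero_mem' := ⟨.zero, by simp⟩
  add_mem' {x y} hx hy := ⟨hx.1.add hy.1, by
    rw [neg_add]; exact hx.2.add hy.2⟩
  smul_mem' a x hx := by
    -- `a = ((a+1)/2)² - ((a-1)/2)²`, so multiples are combinations of `y` and `-y` with square
    -- coefficients.
    have h : ∀ y : A, a * y = (⅟2 * (a + 1)) * (⅟2 * (a + 1)) * y +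
        (⅟2 * (a - 1)) * (⅟2 * (a - 1)) * (-y) := fun y => by
      have h2 : (⅟2 : A) * 2 = 1 := invOf_mul_self 2
      linear_combination (-(a * y * (⅟2 * 2 + 1))) * h2
    refine ⟨?_, ?_⟩
    · rw [smul_eq_mul, h x]
      exact ((IsSumSq.mul_self _).mul hx.1).add ((IsSumSq.mul_self _).mul hx.2)
    · rw [smul_eq_mul, ← mul_neg, h (-x), neg_neg]
      exact ((IsSumSq.mul_self _).mul hx.2).add ((IsSumSq.mul_self _).mul hx.1)

theorem mem_sumSqSupport {x : A} : x ∈ sumSqSupport A ↔ IsSumSq x ∧ IsSumSq (-x) := Iff.rfl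

/-- `(a² + s)ⁿ` is `a²ⁿ` plus a sum of squares, so if its negative is a sum of squares, so is
`-a²ⁿ`. -/
theorem mem_radical_sumSqSupport_of_add_mem {a s : A} (hs : IsSumSq s)
    (h : a * a + s ∈ (sumSqSupport A).radical) : a ∈ (sumSqSupport A).radical := by
  obtain ⟨n, hn⟩ := h
  have key : ∃ s', IsSumSq s' ∧ (a * a + s) ^ n = a ^ n * a ^ n + s' := by
    clear hn
    induction n with
    | zero => exact ⟨0, .zero, by simp⟩
    | succ n ih =>
      obtain ⟨s', hs', h⟩ := ih
      refine ⟨a ^ n * a ^ n * s + s' * (a * a) + s' * s, ?_, by rw [pow_succ, h]; ring⟩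
      exact (((IsSumSq.mul_self _).mul hs).add (hs'.mul (IsSumSq.mul_self _))).add (hs'.mul hs)
  obtain ⟨s', hs', h⟩ := key
  refine ⟨n + n, mem_sumSqSupport.mpr ⟨?_, ?_⟩⟩
  · rw [pow_add]; exact IsSumSq.mul_self _
  · have : -(a ^ (n + n)) = -(a * a + s) ^ n + s' := by rw [h]; ring
    rw [this]
    exact (mem_sumSqSupport.mp hn).2.add hs'

/-- In the localization at `p` only one prime contains `I`, so a power of `x` lies in the extended
ideal; clear denominators. -/
theorem Ideal.exists_notMem_mul_mem_radical_of_mem_minimalPrimes {R : Type*} [CommRing R]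
    {I p : Ideal R} (hp : p ∈ I.minimalPrimes) {x : R} (hx : x ∈ p) :
    ∃ y ∉ p, x * y ∈ I.radical := by
  have : p.IsPrime := hp.1.1
  have hle : p.map (algebraMap R (Localization.AtPrime p)) ≤ (I.map (algebraMap _ _)).radical := by
    rw [Ideal.radical_eq_sInf, le_sInf_iff]
    rintro q ⟨hq', hq⟩
    obtain ⟨h₁, h₂⟩ := ((IsLocalization.AtPrime.orderIsoOfPrime _ p) ⟨q, hq⟩).2
    rw [Ideal.map_le_iff_le_comap] at hq' ⊢
    exact hp.2 ⟨h₁, hq'⟩ h₂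
  obtain ⟨n, hn⟩ := hle (Ideal.mem_map_of_mem _ hx)
  rw [IsLocalization.mem_map_algebraMap_iff (M := p.primeCompl)] at hn
  obtain ⟨⟨a, b⟩, hn⟩ := hn
  rw [← map_pow, ← map_mul, IsLocalization.eq_iff_exists p.primeCompl] at hn
  obtain ⟨t, ht⟩ := hn
  refine ⟨t * b, (t * b).2, n + 1, ?_⟩
  simp only at ht
  have : (x * (t.1 * b.1)) ^ (n + 1) = (t.1 ^ n * b.1 ^ n * x * t.1) * a := by
    rw [mul_assoc, ← ht]; ring
  rw [this]
  exact I.mul_mem_left _ a.2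

/-- Minimal primes of the support are real: a multiplier `y` outside `P` moves the relation into the
radical. This makes their residue fields semireal. -/
theorem mem_of_add_mem_of_mem_minimalPrimes {P : Ideal A}
    (hP : P ∈ (sumSqSupport A).minimalPrimes) {a s : A} (hs : IsSumSq s) (h : a * a + s ∈ P) :
    a ∈ P := by
  have hprime : P.IsPrime := hP.1.1
  obtain ⟨y, hy, hxy⟩ := Ideal.exists_notMem_mul_mem_radical_of_mem_minimalPrimes hP h
  have h1 : (a * y) * (a * y) + s * (y * y) ∈ (sumSqSupport A).radical := by
    have : (a * y) * (a * y) + s * (y * y) = y * ((a * a + s) * y) := by ring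
    rw [this]
    exact Ideal.mul_mem_left _ _ hxy
  have h2 := mem_radical_sumSqSupport_of_add_mem (hs.mul (IsSumSq.mul_self y)) h1
  have h3 : a * y ∈ P := hprime.radical_le_iff.mpr hP.1.2 h2
  exact (hprime.mem_or_mem h3).resolve_right hy

end Support

theorem IsSumSq.exists_mul_self_mul_eq {B F : Type*} [CommRing B] [IsDomain B] [Field F]
    [Algebra B F] [IsFractionRing B F] {z : F} (hz : IsSumSq z) :
    ∃ b s : B, b ≠ 0 ∧ IsSumSq s ∧ algebraMap B F b * algebraMap B F b * z = algebraMap B F s := by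
  induction hz with
  | zero => exact ⟨1, 0, one_ne_zero, .zero, by simp⟩
  | @sq_add a z _ ih =>
    obtain ⟨b, s, hb, hs, h⟩ := ih
    obtain ⟨c, d, hd, rfl⟩ := IsFractionRing.div_surjective (A := B) a
    have hd0 : d ≠ 0 := nonZeroDivisors.ne_zero hd
    have hd1 : algebraMap B F d ≠ 0 := by
      rwa [map_ne_zero_iff _ (IsFractionRing.injective B F)]
    refine ⟨b * d, (b * c) * (b * c) + (d * d) * s, mul_ne_zero hb hd0,
      (IsSumSq.mul_self _).add ((IsSumSq.mul_self _).mul hs), ?_⟩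
    simp only [map_mul, map_add, ← h]
    field_simp

theorem IsSumSq.exists_quotient_mk_eq {A : Type*} [CommRing A] (P : Ideal A) {z : A ⧸ P}
    (hz : IsSumSq z) : ∃ s : A, IsSumSq s ∧ Ideal.Quotient.mk P s = z := by
  induction hz with
  | zero => exact ⟨0, .zero, by simp⟩
  | @sq_add a z _ ih =>
    obtain ⟨s, hs, rfl⟩ := ih
    obtain ⟨a, rfl⟩ := Ideal.Quotient.mk_surjective a
    exact ⟨a * a + s, (IsSumSq.mul_self _).add hs, by simp⟩

section Nullstellensatz

variable {k A : Type*} [Field k] [IsRealClosed k] [CommRing A] [Algebra k A]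

/-- If a prime `P` of a finitely generated algebra has a real closed field over its residue field,
then rational points are dense in its zero locus. -/
theorem IsRealClosed.exists_algHom_ne_zero [Algebra.FiniteType k A] {R : Type*} [Field R]
    [IsRealClosed R] (ψ : A →+* R) {f : A} (hf : ψ f ≠ 0) : ∃ φ : A →ₐ[k] k, φ f ≠ 0 := by
  let : Algebra k R := (ψ.comp (algebraMap k A)).toAlgebra
  let ψ' : A →ₐ[k] R := { ψ with commutes' := fun _ => rfl }
  obtain ⟨n, g, hg⟩ := Algebra.FiniteType.iff_quotient_mvPolynomial''.mp ‹Algebra.FiniteType k A›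
  obtain ⟨f', rfl⟩ := hg f
  let x : Fin n → R := fun i => ψ' (g (MvPolynomial.X i))
  have hx : MvPolynomial.aeval x = ψ'.comp g := MvPolynomial.algHom_ext fun i => by simp [x]
  -- Rabinowitsch's trick: the extra coordinate is the inverse of `f`, which keeps `f` nonzero at
  -- the specialized point.
  obtain ⟨a, ha⟩ := exists_specialization (k := k) (Fin.cons (ψ (g f'))⁻¹ x : Fin (n + 1) → R)
  let b : Fin n → k := fun i => a i.succ
  have hren : ∀ F : MvPolynomial (Fin n) k,
      MvPolynomial.aeval (Fin.cons (ψ (g f'))⁻¹ x : Fin (n + 1) → R)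
        (MvPolynomial.rename Fin.succ F) = ψ (g F) := fun F => by
    rw [MvPolynomial.aeval_rename]
    exact DFunLike.congr_fun hx F
  have hren' : ∀ F : MvPolynomial (Fin n) k,
      MvPolynomial.aeval a (MvPolynomial.rename Fin.succ F) = MvPolynomial.aeval b F := fun F => by
    rw [MvPolynomial.aeval_rename]
    rfl
  have hker : ∀ F, g F = 0 → MvPolynomial.aeval b F = 0 := by
    intro F hF
    rw [← hren']
    refine ha _ ?_
    rw [hren, hF, map_zero]
  have hf' : MvPolynomial.aeval b f' ≠ 0 := by
    intro h0
    have h1 := ha (MvPolynomial.X 0 * MvPolynomial.rename Fin.succ f' - 1) (by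
      rw [map_sub, map_mul, hren, MvPolynomial.aeval_X, Fin.cons_zero, map_one,
        inv_mul_cancel₀ hf, sub_self])
    rw [map_sub, map_mul, hren', h0] at h1
    simp at h1
  let φ : A →ₐ[k] k := (Ideal.Quotient.liftₐ (RingHom.ker g) (MvPolynomial.aeval b)
    fun F hF => hker F hF).comp (Ideal.quotientKerAlgEquivOfSurjective hg).symm.toAlgHom
  refine ⟨φ, ?_⟩
  have h1 : (Ideal.quotientKerAlgEquivOfSurjective hg).symm (g f') =
      Ideal.Quotient.mk (RingHom.ker g) f' := by
    rw [AlgEquiv.symm_apply_eq]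
    rfl
  have h2 : φ (g f') = MvPolynomial.aeval b f' := by
    change Ideal.Quotient.liftₐ (RingHom.ker g) (MvPolynomial.aeval b)
      (fun F hF => hker F hF) ((Ideal.quotientKerAlgEquivOfSurjective hg).symm (g f')) = _
    rw [h1]
    rfl
  rwa [h2]

/-- **Real Nullstellensatz**. -/
theorem mem_radical_sumSqSupport [Algebra.FiniteType k A] [Invertible (2 : A)] {f : A}
    (hf : ∀ φ : A →ₐ[k] k, φ f = 0) : f ∈ (sumSqSupport A).radical := by
  rw [← Ideal.sInf_minimalPrimes, Submodule.mem_sInf]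
  intro (P : Ideal A) hP
  by_contra hfP
  have hprime : P.IsPrime := hP.1.1
  let F := FractionRing (A ⧸ P)
  have : IsSemireal F := isSemireal_iff_not_isSumSq_neg_one.mpr fun h => by
    obtain ⟨b, s, hb, hs, hbs⟩ := h.exists_mul_self_mul_eq (B := A ⧸ P)
    obtain ⟨s, hs', rfl⟩ := hs.exists_quotient_mk_eq
    obtain ⟨b, rfl⟩ := Ideal.Quotient.mk_surjective b
    have h1 : Ideal.Quotient.mk P (b * b + s) = 0 := by
      refine IsFractionRing.injective (A ⧸ P) F ?_
      rw [map_add, map_add, ← hbs, map_mul, map_mul, map_zero]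
      ring
    exact hb (Ideal.Quotient.eq_zero_iff_mem.mpr (mem_of_add_mem_of_mem_minimalPrimes hP hs'
      (Ideal.Quotient.eq_zero_iff_mem.mp h1)))
  obtain ⟨M, hM⟩ := IsSemireal.exists_isRealClosed F
  let ψ : A →+* M := (algebraMap F M).comp ((algebraMap (A ⧸ P) F).comp (Ideal.Quotient.mk P))
  obtain ⟨φ, hφ⟩ := IsRealClosed.exists_algHom_ne_zero (k := k) ψ (f := f) (by
    change algebraMap F M (algebraMap (A ⧸ P) F (Ideal.Quotient.mk P f)) ≠ 0
    rw [_root_.map_ne_zero, map_ne_zero_iff _ (IsFractionRing.injective (A ⧸ P) F), Ne,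
      Ideal.Quotient.eq_zero_iff_mem]
    exact hfP)
  exact hφ (hf φ)

end Nullstellensatz

/-! ### Finite generation over a polynomial ring in one variable -/

section Dimension

/-- Noether normalization in `s` variables; going up lifts a chain of three primes, so `s ≤ 1`.
Injectivity is dropped, so `s = 0` is covered through `k[X] → k`. -/
theorem exists_finite_algHom_of_ringKrullDim_le_one {k B : Type*} [Field k] [CommRing B]
    [Algebra k B] [Algebra.FiniteType k B] (hB : ringKrullDim B ≤ 1) :
    ∃ ψ : k[X] →ₐ[k] B, ψ.Finite := by
  cases subsingleton_or_nontrivial B with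
  | inl h =>
    refine ⟨aeval 0, RingHom.Finite.of_surjective _ fun x => ⟨0, Subsingleton.elim _ _⟩⟩
  | inr h =>
    obtain ⟨s, g, hg, hgf⟩ := exists_finite_inj_algHom_of_fg k B
    have hs : s ≤ 1 := by
      by_contra! hs
      let : Algebra (MvPolynomial (Fin s) k) B := g.toRingHom.toAlgebra
      have : Algebra.IsIntegral (MvPolynomial (Fin s) k) B :=
        ⟨(show g.toRingHom.IsIntegral from RingHom.Finite.to_isIntegral hgf)⟩
      have : FaithfulSMul (MvPolynomial (Fin s) k) B :=
        (faithfulSMul_iff_algebraMap_injective _ _).mpr hg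
      have h2 : (2 : ℕ) ≤ Order.krullDim (PrimeSpectrum (MvPolynomial (Fin s) k)) := by
        change _ ≤ ringKrullDim (MvPolynomial (Fin s) k)
        rw [MvPolynomial.ringKrullDim_of_isNoetherianRing, ringKrullDim_eq_zero_of_field, zero_add,
          Nat.card_fin]
        exact_mod_cast hs
      obtain ⟨l, hl⟩ := Order.le_krullDim_iff.mp h2
      have hlen : (0 : ℕ) < l.length + 1 ∧ 1 < l.length + 1 ∧ 2 < l.length + 1 := by omega
      let p₀ := l ⟨0, hlen.1⟩
      let p₁ := l ⟨1, hlen.2.1⟩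
      let p₂ := l ⟨2, hlen.2.2⟩
      have h01 : p₀ < p₁ := l.strictMono (by simp [Fin.lt_def])
      have h12 : p₁ < p₂ := l.strictMono (by simp [Fin.lt_def])
      obtain ⟨q₀, -, hq₀, hc₀⟩ := Ideal.exists_ideal_over_prime_of_isIntegral p₀.asIdeal
        (⊥ : Ideal B) (by
          rw [← RingHom.ker_eq_comap_bot, (RingHom.injective_iff_ker_eq_bot (algebraMap (MvPolynomial (Fin s) k) B)).mp hg]
          exact bot_le)
      obtain ⟨q₁, hq01, hq₁, hc₁⟩ := Ideal.exists_ideal_over_prime_of_isIntegral p₁.asIdeal q₀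
        (hc₀.le.trans h01.le)
      obtain ⟨q₂, hq12, hq₂, hc₂⟩ := Ideal.exists_ideal_over_prime_of_isIntegral p₂.asIdeal q₁
        (hc₁.le.trans h12.le)
      have h01' : (⟨q₀, hq₀⟩ : PrimeSpectrum B) < ⟨q₁, hq₁⟩ := by
        refine lt_of_le_of_ne hq01 fun h => h01.ne (PrimeSpectrum.ext ?_)
        rw [← hc₀, ← hc₁, show q₀ = q₁ from congrArg PrimeSpectrum.asIdeal h]
      have h12' : (⟨q₁, hq₁⟩ : PrimeSpectrum B) < ⟨q₂, hq₂⟩ := by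
        refine lt_of_le_of_ne hq12 fun h => h12.ne (PrimeSpectrum.ext ?_)
        rw [← hc₁, ← hc₂, show q₁ = q₂ from congrArg PrimeSpectrum.asIdeal h]
      have h3 : (2 : ℕ) ≤ ringKrullDim B :=
        Order.le_krullDim_iff.mpr ⟨LTSeries.mk 2
          ![(⟨q₀, hq₀⟩ : PrimeSpectrum B), ⟨q₁, hq₁⟩, ⟨q₂, hq₂⟩]
          (Fin.strictMono_iff_lt_succ.mpr fun i => by
            fin_cases i
            · exact h01'
            · exact h12'), rfl⟩
      have h4 := h3.trans hB
      norm_cast at h4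
    have hsurj : ∃ θ : k[X] →ₐ[k] MvPolynomial (Fin s) k, Function.Surjective θ := by
      interval_cases s
      · refine ⟨aeval 0, fun F => ?_⟩
        obtain ⟨c, rfl⟩ := MvPolynomial.C_surjective (Fin 0) F
        exact ⟨C c, by rw [aeval_C]; rfl⟩
      · exact ⟨(MvPolynomial.uniqueAlgEquiv k (Fin 1)).symm.toAlgHom,
          (MvPolynomial.uniqueAlgEquiv k (Fin 1)).symm.surjective⟩
    obtain ⟨θ, hθ⟩ := hsurj
    exact ⟨g.comp θ, RingHom.Finite.comp hgf (RingHom.Finite.of_surjective _ hθ)⟩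

theorem ringKrullDim_quotient_le_topologicalKrullDim {A : Type*} [CommRing A] {I : Ideal A}
    {W : Set (PrimeSpectrum A)} (hW : PrimeSpectrum.zeroLocus (I : Set A) ⊆ W) :
    ringKrullDim (A ⧸ I) ≤ topologicalKrullDim W := by
  rw [← PrimeSpectrum.topologicalKrullDim_eq_ringKrullDim]
  have hemb := PrimeSpectrum.isClosedEmbedding_comap_of_surjective (A ⧸ I)
    (Ideal.Quotient.mk I) Ideal.Quotient.mk_surjective
  have hmem : ∀ p, PrimeSpectrum.comap (Ideal.Quotient.mk I) p ∈ W := fun p => hW (by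
    intro x hx
    change Ideal.Quotient.mk I x ∈ p.asIdeal
    rw [Ideal.Quotient.eq_zero_iff_mem.mpr hx]
    exact zero_mem _)
  exact (hemb.isInducing.codRestrict hmem).topologicalKrullDim_le

end Dimension

end

section

open Polynomial IntermediateField Matrix

/-! ### Gram matrices over `k[X]` and `k(i)[X]` -/

namespace IsRealClosed

variable {k : Type*} [Field k] [IsRealClosed k]

/-- Conjugation of the coefficients of polynomials over `k(i)`. -/
noncomputable instance : StarRing (Cx k)[X] where
  star p := p.map (starRingEnd (Cx k))
  star_involutive p := by
    ext1 n
    simp [coeff_map]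
  star_mul p q := by
    rw [Polynomial.map_mul, mul_comm]
  star_add p q := Polynomial.map_add _

theorem star_polynomial_def (p : (Cx k)[X]) : star p = p.map (starRingEnd (Cx k)) := rfl

@[simp] theorem star_C (z : Cx k) : star (C z : (Cx k)[X]) = C (star z) := by
  rw [star_polynomial_def, map_C, starRingEnd_apply]

@[simp] theorem star_X : star (X : (Cx k)[X]) = X := by
  rw [star_polynomial_def, map_X]

theorem eval_star (z : Cx k) (p : (Cx k)[X]) : (star p).eval z = star (p.eval (star z)) := by
  have h := (eval₂_at_apply (p := p) (starRingEnd (Cx k)) (star z))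
  rw [starRingEnd_apply, star_star] at h
  rw [star_polynomial_def, eval_map, h, starRingEnd_apply]

theorem star_mul_self_eq (z : Cx k) :
    star z * z = algebraMap k (Cx k) (z.re * z.re + z.im * z.im) := by
  ext
  · simp
  · simp; ring

/-! ### Anisotropy of sums of norms and orthogonal projections -/

section Anisotropy

variable {m : Type*} [Fintype m]

theorem exists_sum_star_mul_self_eq (v : m → Cx k) :
    ∃ s : k, ∑ i, star (v i) * v i = algebraMap k (Cx k) (s * s) ∧ (s = 0 → v = 0) := by
  obtain ⟨s, hs⟩ := isSquare_of_isSumSq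
    (IsSumSq.sum (I := Finset.univ) fun i _ =>
      (IsSumSq.mul_self (v i).re).add (IsSumSq.mul_self (v i).im))
  refine ⟨s, ?_, fun h0 => ?_⟩
  · rw [← hs, map_sum]
    exact Finset.sum_congr rfl fun i _ => star_mul_self_eq (v i)
  · let := linearOrder k
    have := isStrictOrderedRing (k := k)
    rw [h0, mul_zero, Finset.sum_eq_zero_iff_of_nonneg fun i _ =>
      add_nonneg (mul_self_nonneg _) (mul_self_nonneg _)] at hs
    funext i
    have := hs i (Finset.mem_univ i)
    have h1 : (v i).re = 0 := by nlinarith [mul_self_nonneg (v i).re, mul_self_nonneg (v i).im]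
    have h2 : (v i).im = 0 := by nlinarith [mul_self_nonneg (v i).re, mul_self_nonneg (v i).im]
    ext
    · exact h1
    · exact h2

theorem eq_zero_of_sum_star_mul_self_eq_zero {v : m → Cx k} (h : ∑ i, star (v i) * v i = 0) :
    v = 0 := by
  obtain ⟨s, hs, hs0⟩ := exists_sum_star_mul_self_eq v
  rw [h, eq_comm, map_eq_zero_iff _ (algebraMap k (Cx k)).injective, mul_self_eq_zero] at hs
  exact hs0 hs

/-- Evaluation at the infinitely many points of `k`, which conjugation fixes, reduces this to
constants. -/
theorem eq_zero_of_sum_star_mul_self_polynomial_eq_zero {u : m → (Cx k)[X]}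
    (h : ∑ i, star (u i) * u i = 0) : u = 0 := by
  have : Infinite k := CharZero.infinite k
  have key : ∀ (c : k) i, (u i).eval (algebraMap k (Cx k) c) = 0 := by
    intro c i
    refine congrFun (eq_zero_of_sum_star_mul_self_eq_zero
      (v := fun i => (u i).eval (algebraMap k (Cx k) c)) ?_) i
    have h1 := congrArg (eval (algebraMap k (Cx k) c)) h
    rw [eval_finsetSum, eval_zero] at h1
    rw [← h1]
    refine Finset.sum_congr rfl fun i _ => ?_
    rw [eval_mul, eval_star]
    congr 3
    ext <;> simp
  funext i
  refine eq_zero_of_infinite_isRoot (u i) (Set.Infinite.mono ?_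
    (Set.infinite_range_of_injective (algebraMap k (Cx k)).injective))
  rintro _ ⟨c, rfl⟩
  exact key c i

/-- Orthogonal projection to the space spanned by the columns of a matrix over `k(i)`. -/
theorem exists_orthogonal_projection [DecidableEq m] {n : Type*} [Fintype n]
    (V : Matrix m n (Cx k)) : ∃ P : Matrix m m (Cx k), Pᴴ = P ∧ P * P = P ∧ P * V = V ∧
      ∀ {l : Type} (U : Matrix m l (Cx k)), Vᴴ * U = 0 → P * U = 0 := by
  classical
  -- Gram–Schmidt: a new column has a component `w` orthogonal to the range of `P`, and if `w ≠ 0`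
  -- then `c⁻¹ w wᴴ` is added, where `c = wᴴw` is nonzero by anisotropy.
  have key : ∀ s : Finset n, ∃ P : Matrix m m (Cx k), Pᴴ = P ∧ P * P = P ∧
      (∀ j ∈ s, P *ᵥ Vᵀ j = Vᵀ j) ∧
      ∀ u : m → Cx k, (∀ j ∈ s, star (Vᵀ j) ⬝ᵥ u = 0) → P *ᵥ u = 0 := by
    intro s
    induction s using Finset.induction with
    | empty => exact ⟨0, by simp, by simp, by simp, by simp⟩
    | insert j s hj ih =>
      obtain ⟨P, hP, hPP, hPV, hPu⟩ := ih
      have hadj : ∀ x y : m → Cx k, star (P *ᵥ x) ⬝ᵥ y = star x ⬝ᵥ (P *ᵥ y) := fun x y => by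
        rw [star_mulVec, hP, dotProduct_mulVec]
      set w := Vᵀ j - P *ᵥ Vᵀ j with hw
      have hPw : P *ᵥ w = 0 := by
        rw [hw, mulVec_sub, mulVec_mulVec, hPP, sub_self]
      have hwP : ∀ y, star w ⬝ᵥ (P *ᵥ y) = 0 := fun y => by
        rw [← hadj, hPw, star_zero, zero_dotProduct]
      by_cases hw0 : w = 0
      · refine ⟨P, hP, hPP, fun i hi => ?_, fun u hu =>
          hPu u fun i hi => hu i (Finset.mem_insert_of_mem hi)⟩
        rcases Finset.mem_insert.mp hi with rfl | hi
        · exact (sub_eq_zero.mp hw0).symm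
        · exact hPV i hi
      · set c := star w ⬝ᵥ w with hc
        have hc0 : c ≠ 0 := fun h => hw0 (eq_zero_of_sum_star_mul_self_eq_zero h)
        have hcs : star c = c := (star_dotProduct w w).symm
        let Q := vecMulVec w (star w)
        have hQu : ∀ u, Q *ᵥ u = (star w ⬝ᵥ u) • w := fun u => by
          rw [vecMulVec_mulVec]
          ext1 i
          simp [mul_comm]
        refine ⟨P + c⁻¹ • Q, ?_, ?_, fun i hi => ?_, fun u hu => ?_⟩
        · rw [conjTranspose_add, hP, conjTranspose_smul, conjTranspose_vecMulVec, star_star,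
            star_inv₀, hcs]
        · have h1 : P * Q = 0 := by rw [mul_vecMulVec, hPw, zero_vecMulVec]
          have h2 : Q * P = 0 := by
            have := congrArg conjTranspose h1
            rwa [conjTranspose_mul, conjTranspose_vecMulVec, star_star, hP,
              conjTranspose_zero] at this
          have h3 : Q * Q = c • Q := by
            rw [vecMulVec_mul_vecMulVec, ← hc]
            ext1 i j
            simp only [vecMulVec_apply, Q, Matrix.smul_apply, smul_eq_mul, Pi.smul_apply]
            ring
          rw [add_mul, mul_add, mul_add, hPP, Matrix.mul_smul, h1, Matrix.smul_mul, h2,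
            Matrix.smul_mul, Matrix.mul_smul, h3, smul_smul c⁻¹ c, inv_mul_cancel₀ hc0]
          simp
        · rw [add_mulVec, smul_mulVec, hQu]
          rcases Finset.mem_insert.mp hi with rfl | hi
          · have h1 : star w ⬝ᵥ Vᵀ i = c := by
              have : Vᵀ i = w + P *ᵥ Vᵀ i := by rw [hw]; simp
              rw [this, dotProduct_add, hwP, add_zero]
            rw [h1, smul_smul, inv_mul_cancel₀ hc0, one_smul, hw]
            simp
          · have h1 : star w ⬝ᵥ Vᵀ i = 0 := by
              rw [← hPV i hi, hwP]
            rw [h1, hPV i hi]; simp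
        · have h0 : P *ᵥ u = 0 := hPu u fun i hi => hu i (Finset.mem_insert_of_mem hi)
          have h1 : star w ⬝ᵥ u = 0 := by
            rw [hw, star_sub, sub_dotProduct, hu j (Finset.mem_insert_self _ _), hadj, h0]
            simp
          rw [add_mulVec, smul_mulVec, hQu, h1, h0]
          simp
  obtain ⟨P, hP, hPP, hPV, hPu⟩ := key Finset.univ
  refine ⟨P, hP, hPP, ?_, fun U hU => ?_⟩
  · ext1 i j
    exact congrFun (hPV j (Finset.mem_univ j)) i
  · ext1 i j
    exact congrFun (hPu (Uᵀ j) fun l _ => congrFun (congrFun hU l) j) i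

end Anisotropy

end IsRealClosed

end

/-! ### Division of Gram matrices and reduction to square size -/

section

open Polynomial IntermediateField Matrix

namespace IsRealClosed

variable {k : Type*} [Field k] [IsRealClosed k]

section Division

theorem X_sub_C_mul_ne_zero (z w : Cx k) : ((X - C z) * (X - C w) : (Cx k)[X]) ≠ 0 :=
  mul_ne_zero (X_sub_C_ne_zero z) (X_sub_C_ne_zero w)

theorem map_eval_conjTranspose {m n : Type} (z : Cx k) (N : Matrix m n (Cx k)[X]) :
    Nᴴ.map (eval z) = (N.map (eval (star z)))ᴴ := by
  ext1 i j
  simp only [map_apply, conjTranspose_apply, eval_star]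

theorem map_eval_mul {l m n : Type} [Fintype m] (z : Cx k) (M : Matrix l m (Cx k)[X]) (N : Matrix m n (Cx k)[X]) :
    (M * N).map (eval z) = M.map (eval z) * N.map (eval z) :=
  Matrix.map_mul (f := evalRingHom z)

variable {m n : Type} [Fintype m] [DecidableEq m] [Fintype n]

/-- Division of a Gram matrix by a polynomial `(X - z) (X - z̄)`. -/
theorem exists_conjTranspose_mul_self_eq_of_smul_X_sub_C {z : Cx k} {N : Matrix m n (Cx k)[X]}
    {M : Matrix n n (Cx k)[X]}
    (h : Nᴴ * N = ((X - C z) * (X - C (star z)) : (Cx k)[X]) • M) :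
    ∃ N' : Matrix m n (Cx k)[X], N'ᴴ * N' = M := by
  set f : (Cx k)[X] := (X - C z) * (X - C (star z)) with hf
  have hf0 : f ≠ 0 := X_sub_C_mul_ne_zero _ _
  have hfs : star f = f := by
    rw [hf, star_mul', star_sub, star_sub, star_X, star_C, star_C, star_star, mul_comm]
  let V := N.map (eval (star z))
  let U := N.map (eval z)
  -- At `z` the right-hand side vanishes, so the columns of `N(z̄)` and `N(z)` are orthogonal.
  have hVU : Vᴴ * U = 0 := by
    have h1 := congrArg (fun M : Matrix n n (Cx k)[X] => M.map (eval z)) h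
    simp only [map_eval_mul, map_eval_conjTranspose] at h1
    rw [h1]
    ext1 i j
    simp [hf]
  obtain ⟨P, hP, hPP, hPV, hPU⟩ := exists_orthogonal_projection V
  have hPU := hPU U hVU
  by_cases hz : star z = z
  · have hU0 : U = 0 := by
      rw [← hPU]
      have : V = U := by simp only [V, U, hz]
      rw [← this, hPV]
    have hdvd : ∀ i j, (X - C z) ∣ N i j := fun i j =>
      dvd_iff_isRoot.mpr (congrFun (congrFun hU0 i) j)
    choose N' hN' using hdvd
    have hN : N = (X - C z : (Cx k)[X]) • (Matrix.of N') := by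
      ext1 i j
      rw [hN', Matrix.smul_apply, of_apply, smul_eq_mul]
    refine ⟨Matrix.of N', ?_⟩
    rw [hN, conjTranspose_smul, Matrix.smul_mul, Matrix.mul_smul, smul_smul, star_sub, star_X,
      star_C, mul_comm, ← hf] at h
    exact smul_right_injective _ hf0 h
  · let P' : Matrix m m (Cx k)[X] := P.map C
    have hPC : ∀ i j, P' i j = C (P i j) := fun _ _ => rfl
    have hP' : P'ᴴ = P' := by
      ext1 i j
      rw [conjTranspose_apply, hPC, hPC, star_C]
      congr 1
      exact congrFun (congrFun hP i) j
    have hPP' : P' * P' = P' := by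
      rw [← Matrix.map_mul (f := (C : Cx k →+* _)), hPP]
    -- `F` is unitary up to the factor `f`. Since `F(z)` is a multiple of `P` and `F(z̄)` one of `1
    -- - P`, both values of `F N` vanish, and `N' = F N / f`.
    let F : Matrix m m (Cx k)[X] :=
      (X - C (star z) : (Cx k)[X]) • P' + (X - C z : (Cx k)[X]) • (1 - P')
    have hFF : Fᴴ * F = f • (1 : Matrix m m (Cx k)[X]) := by
      have h1 : Fᴴ = (X - C z : (Cx k)[X]) • P' + (X - C (star z) : (Cx k)[X]) • (1 - P') := by
        simp only [F]
        rw [conjTranspose_add, conjTranspose_smul, conjTranspose_smul, conjTranspose_sub, hP',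
          conjTranspose_one, star_sub, star_sub, star_X, star_C, star_C, star_star]
      have h2 : P' * (1 - P') = 0 := by rw [mul_sub, mul_one, hPP', sub_self]
      have h3 : (1 - P') * P' = 0 := by rw [sub_mul, one_mul, hPP', sub_self]
      have h4 : (1 - P') * (1 - P') = 1 - P' := by rw [mul_sub, mul_one, h3, sub_zero]
      rw [h1]
      simp only [F, add_mul, mul_add, Matrix.smul_mul, Matrix.mul_smul, hPP', h2, h3, h4,
        smul_zero, smul_smul, add_zero, zero_add]
      rw [mul_comm (X - C (star z)), ← hf, ← smul_add]
      simp
    have hFe : ∀ w : Cx k, F.map (eval w) = (w - star z) • P + (w - z) • (1 - P) := by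
      intro w
      ext1 i j
      have : (1 : Matrix m m (Cx k)[X]) i j = C ((1 : Matrix m m (Cx k)) i j) := by
        rw [one_apply, one_apply]; split_ifs <;> simp
      simp [F, P', this]
    have hG1 : (F * N).map (eval z) = 0 := by
      rw [map_eval_mul, hFe]
      change _ * U = 0
      rw [sub_self, zero_smul, add_zero, Matrix.smul_mul, hPU, smul_zero]
    have hG2 : (F * N).map (eval (star z)) = 0 := by
      rw [map_eval_mul, hFe]
      change _ * V = 0
      rw [sub_self, zero_smul, zero_add, Matrix.smul_mul, Matrix.sub_mul, Matrix.one_mul, hPV, sub_self,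
        smul_zero]
    have hdvd : ∀ i j, f ∣ (F * N) i j := fun i j =>
      (isCoprime_X_sub_C_of_isUnit_sub
        (isUnit_iff_ne_zero.mpr (sub_ne_zero.mpr fun h => hz h.symm))).mul_dvd
        (dvd_iff_isRoot.mpr (congrFun (congrFun hG1 i) j))
        (dvd_iff_isRoot.mpr (congrFun (congrFun hG2 i) j))
    choose N' hN' using hdvd
    have hN : F * N = f • (Matrix.of N') := by
      ext1 i j
      rw [hN', Matrix.smul_apply, of_apply, smul_eq_mul]
    refine ⟨Matrix.of N', ?_⟩
    have h1 : (F * N)ᴴ * (F * N) = (f * f) • M := by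
      rw [conjTranspose_mul, Matrix.mul_assoc, ← Matrix.mul_assoc Fᴴ, hFF, Matrix.smul_mul,
        Matrix.mul_smul, Matrix.one_mul, h, smul_smul]
    rw [hN, conjTranspose_smul, hfs, Matrix.smul_mul, Matrix.mul_smul, smul_smul] at h1
    exact smul_right_injective _ (mul_ne_zero hf0 hf0) h1

/-- Division of a Gram matrix by a nonzero sum of norms. -/
theorem exists_conjTranspose_mul_self_eq_of_smul {p : Type} [Fintype p] [DecidableEq p]
    {u : p → (Cx k)[X]} {a : (Cx k)[X]} (ha : ∑ i, star (u i) * u i = a) (ha0 : a ≠ 0)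
    {N : Matrix m n (Cx k)[X]} {M : Matrix n n (Cx k)[X]} (h : Nᴴ * N = a • M) :
    ∃ N' : Matrix m n (Cx k)[X], N'ᴴ * N' = M := by
  induction hd : a.natDegree using Nat.strong_induction_on generalizing u a N with
  | _ d ih =>
  have hev : ∀ z, a.eval z = ∑ i, star ((u i).eval (star z)) * (u i).eval z := fun z => by
    rw [← ha, eval_finsetSum]
    exact Finset.sum_congr rfl fun i _ => by rw [eval_mul, eval_star]
  rcases Nat.eq_zero_or_pos d with rfl | hpos
  · obtain ⟨c, rfl⟩ := natDegree_eq_zero.mp hd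
    obtain ⟨s, hs, -⟩ := exists_sum_star_mul_self_eq fun i => (u i).eval 0
    have h0 := hev 0
    rw [star_zero, hs, eval_C] at h0
    set σ := algebraMap k (Cx k) s with hσ
    have hσ0 : σ ≠ 0 := fun h1 => ha0 (by rw [h0, map_mul, ← hσ, h1]; simp)
    have hσs : star σ = σ := by ext <;> simp [hσ]
    refine ⟨(C σ⁻¹ : (Cx k)[X]) • N, ?_⟩
    rw [conjTranspose_smul, Matrix.smul_mul, Matrix.mul_smul, h, smul_smul, smul_smul, star_C,
      star_inv₀, hσs, h0, map_mul, ← hσ, ← C_mul, ← C_mul]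
    have : σ⁻¹ * σ⁻¹ * (σ * σ) = 1 := by field_simp
    rw [← mul_assoc] at this
    rw [← mul_assoc, this, C_1, one_smul]
  · obtain ⟨z, hz⟩ := IsAlgClosed.exists_root a (by
      rw [degree_eq_natDegree ha0, hd]
      exact_mod_cast hpos.ne')
    -- At a real root all `u i` vanish, so the root is double; a nonreal root comes with its
    -- conjugate.
    have hdvd : (X - C z) * (X - C (star z)) ∣ a := by
      by_cases hzz : star z = z
      · have h1 := hev z
        rw [hzz, hz.eq_zero] at h1
        have h2 := eq_zero_of_sum_star_mul_self_eq_zero h1.symm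
        have h3 : ∀ i, (X - C z) ∣ u i := fun i => dvd_iff_isRoot.mpr (congrFun h2 i)
        rw [← ha]
        refine Finset.dvd_sum fun i _ => ?_
        obtain ⟨v, hv⟩ := h3 i
        rw [hv, star_mul', star_sub, star_X, star_C, hzz]
        exact ⟨star v * v, by ring⟩
      · have hsa : star a = a := by
          rw [← ha, star_sum]
          exact Finset.sum_congr rfl fun i _ => by rw [star_mul', star_star, mul_comm]
        refine (isCoprime_X_sub_C_of_isUnit_sub
          (isUnit_iff_ne_zero.mpr (sub_ne_zero.mpr fun h => hzz h.symm))).mul_dvd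
          (dvd_iff_isRoot.mpr hz) (dvd_iff_isRoot.mpr ?_)
        rw [IsRoot, ← hsa, eval_star, star_star, hz.eq_zero, star_zero]
    obtain ⟨a', ha'⟩ := hdvd
    have ha'0 : a' ≠ 0 := by rintro rfl; exact ha0 (by rw [ha', mul_zero])
    -- The division lemma for the `1 × 1` Gram matrix `a` shows that the quotient `a'` is again a
    -- sum of norms.
    have hu : (Matrix.of fun (i : p) (_ : Unit) => u i)ᴴ * (Matrix.of fun (i : p) (_ : Unit) => u i)
        = ((X - C z) * (X - C (star z)) : (Cx k)[X]) • (Matrix.of fun (_ _ : Unit) => a') := by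
      ext1 i j
      rw [Matrix.mul_apply, Matrix.smul_apply, smul_eq_mul, of_apply, ← ha', ← ha]
      rfl
    obtain ⟨u', hu'⟩ := exists_conjTranspose_mul_self_eq_of_smul_X_sub_C hu
    rw [ha', ← smul_smul] at h
    obtain ⟨N₁, hN₁⟩ := exists_conjTranspose_mul_self_eq_of_smul_X_sub_C h
    refine ih a'.natDegree ?_ (u := fun i => u' i ()) ?_ ha'0 hN₁ rfl
    · rw [← hd, ha', natDegree_mul (X_sub_C_mul_ne_zero _ _) ha'0,
        natDegree_mul (X_sub_C_ne_zero _) (X_sub_C_ne_zero _), natDegree_X_sub_C,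
        natDegree_X_sub_C]
      omega
    · have := congrFun (congrFun hu' ()) ()
      rw [Matrix.mul_apply] at this
      exact this

end Division

/-- Every Gram matrix of size `n` over `k(i)[X]` is the Gram matrix of a square matrix. -/
theorem exists_square_conjTranspose_mul_self_eq (n : ℕ) : ∀ {m : Type} [Fintype m] [DecidableEq m]
    (N : Matrix m (Fin n) (Cx k)[X]), ∃ N' : Matrix (Fin n) (Fin n) (Cx k)[X],
      N'ᴴ * N' = Nᴴ * N := by
  induction n with
  | zero => exact fun N => ⟨0, by ext1 i; exact i.elim0⟩
  | succ n ih =>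
    intro m _ _ N
    let u : m → (Cx k)[X] := fun i => N i 0
    let a := ∑ i, star (u i) * u i
    let G := Nᴴ * N
    have hG : ∀ j l, G j l = ∑ i, star (N i j) * N i l := fun j l => Matrix.mul_apply
    by_cases ha0 : a = 0
    · have hu := eq_zero_of_sum_star_mul_self_polynomial_eq_zero ha0
      obtain ⟨N₁, hN₁⟩ := ih (Matrix.of fun i (j : Fin n) => N i j.succ)
      have hu' : ∀ i, N i 0 = 0 := fun i => congrFun hu i
      have h1 : ∀ j l, ∑ i, star (N₁ i j) * N₁ i l = ∑ i, star (N i j.succ) * N i l.succ :=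
        fun j l => by
          have := congrFun (congrFun hN₁ j) l
          rwa [Matrix.mul_apply, Matrix.mul_apply] at this
      refine ⟨Matrix.of (Fin.cons 0 fun i => Fin.cons 0 (N₁ i)), ?_⟩
      change _ = G
      ext1 j l
      rw [Matrix.mul_apply, hG, Fin.sum_univ_succ]
      refine Fin.cases ?_ (fun j => ?_) j
      · simp [hu']
      · refine Fin.cases ?_ (fun l => ?_) l
        · simp [hu']
        · simpa using h1 j l
    -- The factor `√(1/2)` compensates for counting each pair of rows twice in Lagrange's identity.
    · obtain ⟨s, hs⟩ : IsSquare (2⁻¹ : k) := isSquare_of_isSumSq (by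
        have : (2⁻¹ : k) = 2⁻¹ * 2⁻¹ + 2⁻¹ * 2⁻¹ := by norm_num
        rw [this]
        exact (IsSumSq.mul_self _).add (IsSumSq.mul_self _))
      let σ : (Cx k)[X] := C (algebraMap k (Cx k) s)
      have hσs : star σ = σ := by
        simp only [σ, star_C]
        congr 1
        ext <;> simp
      have hσ : σ * σ * 2 = 1 := by
        simp only [σ]
        rw [← C_mul, ← map_mul, ← hs, ← C_ofNat, ← C_mul, ← map_ofNat (algebraMap k (Cx k)) 2,
          ← map_mul, inv_mul_cancel₀ two_ne_zero, map_one, C_1]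
      -- By Lagrange's identity the Gram matrix of these minors is the Schur complement of `a` in `a
      -- G`.
      let W : Matrix (m × m) (Fin n) (Cx k)[X] := Matrix.of fun i j =>
        σ * (u i.1 * N i.2 j.succ - u i.2 * N i.1 j.succ)
      obtain ⟨N₁, hN₁⟩ := ih W
      have hW : ∀ j l, ∑ i, star (N₁ i j) * N₁ i l =
          a * G j.succ l.succ - star (G 0 j.succ) * G 0 l.succ := by
        intro j l
        have h0 := congrFun (congrFun hN₁ j) l
        rw [Matrix.mul_apply, Matrix.mul_apply] at h0
        refine h0.trans ?_
        rw [Fintype.sum_prod_type]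
        have e1 : ∀ i i' : m, Wᴴ j (i, i') * W (i, i') l =
            σ * σ * ((star (u i) * u i) * (star (N i' j.succ) * N i' l.succ)
              + (star (N i j.succ) * N i l.succ) * (star (u i') * u i')
              - (star (u i) * N i l.succ) * (star (N i' j.succ) * u i')
              - (star (N i j.succ) * u i) * (star (u i') * N i' l.succ)) := by
          intro i i'
          simp only [W, conjTranspose_apply, of_apply, star_mul', star_sub, hσs]
          ring
        simp only [e1, ← Finset.mul_sum, Finset.sum_sub_distrib, Finset.sum_add_distrib,
          ← Finset.sum_mul]
        rw [hG, hG, hG]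
        have e2 : star (∑ i, star (N i 0) * N i j.succ) = ∑ i, star (N i j.succ) * u i := by
          rw [star_sum]
          exact Finset.sum_congr rfl fun i _ => by rw [star_mul', star_star, mul_comm]
        rw [e2]
        change σ * σ * (a * _ + _ * a - (∑ i, star (u i) * N i l.succ) * _
          - _ * (∑ i, star (u i) * N i l.succ)) = a * _ - _ * (∑ i, star (u i) * N i l.succ)
        linear_combination (a * (∑ i, star (N i j.succ) * N i l.succ)
          - (∑ i, star (N i j.succ) * u i) * ∑ i, star (u i) * N i l.succ) * hσ
      have hG00 : G 0 0 = a := hG 0 0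
      have hGs : ∀ j l, star (G j l) = G l j := fun j l => by
        rw [hG, hG, star_sum]
        exact Finset.sum_congr rfl fun i _ => by rw [star_mul', star_star, mul_comm]
      -- The first row of `G` on top of `(0 | N₁)` restores the part subtracted in the Schur
      -- complement: the Gram matrix is `a G`.
      let N₂ : Matrix (Fin (n + 1)) (Fin (n + 1)) (Cx k)[X] :=
        Matrix.of (Fin.cons (G 0) fun i => Fin.cons 0 (N₁ i))
      refine exists_conjTranspose_mul_self_eq_of_smul (u := u) rfl ha0 (N := N₂) ?_
      change _ = a • G
      ext1 j l
      rw [Matrix.mul_apply, Fin.sum_univ_succ, Matrix.smul_apply, smul_eq_mul]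
      refine Fin.cases ?_ (fun j => ?_) j
      · have ha : star a = a := by rw [← hG00, hGs]
        simp [N₂, ha, hG00]
      · refine Fin.cases ?_ (fun l => ?_) l
        · simp [N₂, hGs, hG00, mul_comm]
        · have := hW j l
          simp only [N₂, conjTranspose_apply, of_apply, Fin.cons_zero, Fin.cons_succ]
          linear_combination this

section RealPart

theorem exists_eq_map_add_map (q : (Cx k)[X]) : ∃ a b : k[X],
    q = a.map (algebraMap k (Cx k)) + C QuadraticAlgebra.omega * b.map (algebraMap k (Cx k)) := by
  induction q using Polynomial.induction_on' with
  | add p q hp hq =>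
    obtain ⟨a, b, rfl⟩ := hp
    obtain ⟨c, d, rfl⟩ := hq
    exact ⟨a + c, b + d, by simp only [Polynomial.map_add]; ring⟩
  | monomial n z =>
    refine ⟨monomial n z.re, monomial n z.im, ?_⟩
    rw [map_monomial, map_monomial, C_mul_monomial, ← map_add (monomial n)]
    congr 1
    ext <;> simp

theorem eq_of_map_eq_map_add_map {a b c : k[X]}
    (h : a.map (algebraMap k (Cx k)) =
      b.map (algebraMap k (Cx k)) + C QuadraticAlgebra.omega * c.map (algebraMap k (Cx k))) :
    a = b := by
  ext1 n
  have := congrArg (fun q : (Cx k)[X] => (q.coeff n).re) h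
  simpa using this

theorem star_map_algebraMap (a : k[X]) :
    star (a.map (algebraMap k (Cx k))) = a.map (algebraMap k (Cx k)) := by
  rw [star_polynomial_def, Polynomial.map_map]
  congr 1
  ext z <;> simp [starRingEnd_apply]

/-- Every Gram matrix of size `n` over `k[X]` is the Gram matrix of a `2n × n` matrix. -/
theorem exists_transpose_mul_self_eq {m n : ℕ} (N : Matrix (Fin m) (Fin n) k[X]) :
    ∃ A B : Matrix (Fin n) (Fin n) k[X], ∀ i j,
      ∑ l, N l i * N l j = ∑ l, A l i * A l j + ∑ l, B l i * B l j := by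
  obtain ⟨N', hN'⟩ := exists_square_conjTranspose_mul_self_eq n
    (N.map fun a => a.map (algebraMap k (Cx k)))
  choose A B hAB using fun i j => exists_eq_map_add_map (N' i j)
  refine ⟨Matrix.of A, Matrix.of B, fun i j => ?_⟩
  -- With `N' = A + iB`, the real part of `N'ᴴN'` is `AᵀA + BᵀB`, and `c` is its imaginary part.
  refine eq_of_map_eq_map_add_map (c := ∑ l, (A l i * B l j - B l i * A l j)) ?_
  have h := congrFun (congrFun hN' i) j
  rw [Matrix.mul_apply, Matrix.mul_apply] at h
  simp only [conjTranspose_apply, map_apply, star_map_algebraMap] at h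
  simp only [Polynomial.map_sum, Polynomial.map_add, Polynomial.map_mul, Polynomial.map_sub,
    of_apply]
  rw [← h, Finset.mul_sum, ← Finset.sum_add_distrib, ← Finset.sum_add_distrib]
  refine Finset.sum_congr rfl fun l _ => ?_
  have hω : star (C QuadraticAlgebra.omega : (Cx k)[X]) = -C QuadraticAlgebra.omega := by
    rw [star_C, ← C_neg]
    congr 1
    ext <;> simp
  have hω2 : (C QuadraticAlgebra.omega * C QuadraticAlgebra.omega : (Cx k)[X]) = -1 := by
    rw [← C_mul, QuadraticAlgebra.omega_mul_omega_eq_add, ← C_1, ← C_neg]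
    congr 1
    ext <;> simp
  rw [hAB l i, hAB l j, star_add, star_mul', star_map_algebraMap, star_map_algebraMap, hω]
  linear_combination (-((B l i).map (algebraMap k (Cx k)) * (B l j).map (algebraMap k (Cx k)))) * hω2

end RealPart

/-- Sums of squares in an algebra which is finite over `k[X]` have bounded length. -/
theorem exists_sumsOfNSquares_of_finite {B : Type*} [CommRing B] [Algebra k B]
    (ψ : k[X] →ₐ[k] B) (hψ : ψ.Finite) :
    ∃ r : ℕ, ∀ (m : ℕ), sumsOfNSquares B m ⊆ sumsOfNSquares B r := by
  let : Algebra k[X] B := ψ.toRingHom.toAlgebra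
  have : Module.Finite k[X] B := hψ
  obtain ⟨n, e, he⟩ := Module.Finite.exists_fin (R := k[X]) (M := B)
  refine ⟨n + n, ?_⟩
  rintro m x ⟨b, rfl⟩
  have hb : ∀ l, ∃ c : Fin n → k[X], ∑ j, c j • e j = b l := fun l =>
    (Submodule.mem_span_range_iff_exists_fun _).mp (he ▸ Submodule.mem_top)
  choose N hN using hb
  obtain ⟨A, D, hAD⟩ := exists_transpose_mul_self_eq (Matrix.of N)
  -- The sum of squares depends on the coefficients only through their Gram matrix.
  have key : ∀ {p : ℕ} (M : Fin p → Fin n → k[X]), ∑ l, (∑ j, M l j • e j) ^ 2 =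
      ∑ i, ∑ j, (∑ l, M l i * M l j) • (e i * e j) := by
    intro p M
    simp only [pow_two, Finset.sum_mul_sum, smul_mul_smul_comm, Finset.sum_smul]
    rw [Finset.sum_comm]
    exact Finset.sum_congr rfl fun i _ => Finset.sum_comm
  refine ⟨Fin.append (fun l => ∑ j, A l j • e j) (fun l => ∑ j, D l j • e j), ?_⟩
  rw [Fin.sum_univ_add]
  simp only [Fin.append_left, Fin.append_right]
  have hx : ∑ i, b i ^ 2 = ∑ i, ∑ j, (∑ l, N l i * N l j) • (e i * e j) := by
    rw [← key N]
    simp only [hN]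
  refine hx.trans (Eq.trans ?_ (congrArg₂ (· + ·) (key fun l j => A l j) (key fun l j => D l j)).symm)
  rw [← Finset.sum_add_distrib]
  refine Finset.sum_congr rfl fun i _ => ?_
  rw [← Finset.sum_add_distrib]
  refine Finset.sum_congr rfl fun j _ => ?_
  rw [← add_smul, ← hAD i j]
  rfl

end IsRealClosed

end

section

open Polynomial

/-! ### Lengths of sums of squares -/

section Length

variable {A : Type*} [CommRing A]

theorem mem_sumsOfNSquares_of_fintype {ι : Type*} [Fintype ι] {x : A} {n : ℕ} (a : ι → A)
    (hx : x = ∑ i, a i ^ 2) (hn : Fintype.card ι = n) : x ∈ sumsOfNSquares A n := by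
  let e := Fintype.equivFinOfCardEq hn
  exact ⟨fun i => a (e.symm i), by rw [hx, Equiv.sum_comp e.symm fun i => a i ^ 2]⟩

theorem add_mem_sumsOfNSquares {x y : A} {m n : ℕ} (hx : x ∈ sumsOfNSquares A m)
    (hy : y ∈ sumsOfNSquares A n) : x + y ∈ sumsOfNSquares A (m + n) := by
  obtain ⟨a, rfl⟩ := hx
  obtain ⟨b, rfl⟩ := hy
  exact mem_sumsOfNSquares_of_fintype (Sum.elim a b) (by simp) (by simp)

theorem sq_mul_mem_sumsOfNSquares {x : A} {n : ℕ} (c : A) (hx : x ∈ sumsOfNSquares A n) :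
    c ^ 2 * x ∈ sumsOfNSquares A n := by
  obtain ⟨a, rfl⟩ := hx
  exact ⟨fun i => c * a i, by simp only [mul_pow, Finset.mul_sum]⟩

theorem zero_mem_sumsOfNSquares (n : ℕ) : (0 : A) ∈ sumsOfNSquares A n :=
  ⟨0, by simp⟩

theorem sumsOfNSquares_mono {m n : ℕ} (h : m ≤ n) : sumsOfNSquares A m ⊆ sumsOfNSquares A n := by
  intro x hx
  obtain ⟨d, rfl⟩ := Nat.exists_eq_add_of_le h
  simpa using add_mem_sumsOfNSquares hx (zero_mem_sumsOfNSquares d)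

theorem sum_mem_sumsOfNSquares {l n : ℕ} {x : Fin l → A} (hx : ∀ i, x i ∈ sumsOfNSquares A n) :
    ∑ i, x i ∈ sumsOfNSquares A (l * n) := by
  choose a ha using hx
  exact mem_sumsOfNSquares_of_fintype (fun p : Fin l × Fin n => a p.1 p.2)
    (by rw [Fintype.sum_prod_type]; exact Finset.sum_congr rfl fun i _ => ha i) (by simp)

theorem IsSumSq.exists_mem_sumsOfNSquares {x : A} (hx : IsSumSq x) :
    ∃ n, x ∈ sumsOfNSquares A n := by
  induction hx with
  | zero => exact ⟨0, zero_mem_sumsOfNSquares 0⟩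
  | sq_add a _ ih =>
    obtain ⟨n, hn⟩ := ih
    refine ⟨1 + n, add_mem_sumsOfNSquares ⟨fun _ => a, ?_⟩ hn⟩
    simp [pow_two]

theorem pythagorasNumber_lt_top_of_forall {r : ℕ}
    (h : ∀ m, sumsOfNSquares A m ⊆ sumsOfNSquares A r) : pythagorasNumber A < ⊤ := by
  -- `r` may be zero, while lengths start at one.
  refine lt_of_le_of_lt (b := ((r + 1 : ℕ) : ℕ∞)) ?_ (ENat.natCast_lt_top _)
  refine iSup₂_le fun a ha => ?_
  obtain ⟨m, hm⟩ := Set.mem_iUnion.mp ha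
  obtain ⟨-, hm⟩ := Set.mem_iUnion.mp hm
  exact Nat.cast_le.mpr (Nat.sInf_le
    ⟨Nat.le_add_left 1 r, sumsOfNSquares_mono (Nat.le_succ r) (h m hm)⟩)

/-- The elements of the support ideal have bounded length. -/
theorem exists_sumSqSupport_subset_sumsOfNSquares [Invertible (2 : A)] [IsNoetherianRing A] :
    ∃ r, ∀ x ∈ sumSqSupport A, x ∈ sumsOfNSquares A r := by
  obtain ⟨l, g, hg⟩ := Submodule.fg_iff_exists_fin_generating_family.mp
    (IsNoetherian.noetherian (sumSqSupport A))
  have hgI : ∀ i, g i ∈ sumSqSupport A := fun i => hg ▸ Submodule.subset_span ⟨i, rfl⟩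
  choose n hn using fun i => (mem_sumSqSupport.mp (hgI i)).1.exists_mem_sumsOfNSquares
  choose n' hn' using fun i => (mem_sumSqSupport.mp (hgI i)).2.exists_mem_sumsOfNSquares
  let N := ∑ i, (n i + n' i)
  have hle : ∀ i, n i + n' i ≤ N := fun i =>
    Finset.single_le_sum (f := fun i => n i + n' i) (fun _ _ => Nat.zero_le _) (Finset.mem_univ i)
  refine ⟨l * (N + N), fun x hx => ?_⟩
  rw [← hg] at hx
  obtain ⟨c, rfl⟩ := (Submodule.mem_span_range_iff_exists_fun _).mp hx
  refine sum_mem_sumsOfNSquares fun i => ?_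
  have h2 : (⅟2 : A) * 2 = 1 := invOf_mul_self 2
  have : c i • g i = (⅟2 * (c i + 1)) ^ 2 * g i + (⅟2 * (c i - 1)) ^ 2 * (-g i) := by
    rw [smul_eq_mul]
    linear_combination (-(c i * g i * (⅟2 * 2 + 1))) * h2
  rw [this]
  have h := hle i
  exact add_mem_sumsOfNSquares
    (sq_mul_mem_sumsOfNSquares _ (sumsOfNSquares_mono (by omega) (hn i)))
    (sq_mul_mem_sumsOfNSquares _ (sumsOfNSquares_mono (by omega) (hn' i)))

/-- Lifting a representation by `r` squares from `A ⧸ I` leaves an error in `I`, which costs at most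
`q` more squares. -/
theorem sumsOfNSquares_subset_of_quotient {I : Ideal A} {q r : ℕ}
    (hI : ∀ x ∈ I, x ∈ sumsOfNSquares A q)
    (hr : ∀ m, sumsOfNSquares (A ⧸ I) m ⊆ sumsOfNSquares (A ⧸ I) r) (m : ℕ) :
    sumsOfNSquares A m ⊆ sumsOfNSquares A (r + q) := by
  rintro x ⟨a, rfl⟩
  obtain ⟨b, hb⟩ := hr m ⟨fun i => Ideal.Quotient.mk I (a i), rfl⟩
  choose c hc using fun i => Ideal.Quotient.mk_surjective (I := I) (b i)
  have h : ∑ i, a i ^ 2 - ∑ i, c i ^ 2 ∈ I := by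
    rw [← Ideal.Quotient.eq_zero_iff_mem, map_sub, map_sum, map_sum, sub_eq_zero]
    simp only [map_pow, hc]
    exact hb
  have h1 := add_mem_sumsOfNSquares (x := ∑ i, c i ^ 2) (m := r) ⟨c, rfl⟩ (hI _ h)
  rwa [add_sub_cancel] at h1

end Length

/-- The closure is cut out by the functions vanishing at all rational points, and these lie in the
radical of the support by the real Nullstellensatz. -/
theorem zeroLocus_sumSqSupport_subset_closure {k A : Type*} [Field k] [IsRealClosed k]
    [CommRing A] [Algebra k A] [Algebra.FiniteType k A] [Invertible (2 : A)] :
    PrimeSpectrum.zeroLocus (sumSqSupport A : Set A) ⊆ closure (rationalPoints k A) := by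
  rw [← PrimeSpectrum.zeroLocus_vanishingIdeal_eq_closure]
  intro p hp f hf
  have h1 : ∀ φ : A →ₐ[k] k, φ f = 0 := fun φ =>
    (PrimeSpectrum.mem_vanishingIdeal _ _).mp hf ⟨RingHom.ker φ, RingHom.ker_isPrime φ⟩ ⟨φ, rfl⟩
  exact p.2.radical_le_iff.mpr hp (mem_radical_sumSqSupport h1)

end

theorem mainTheorem2 {k A : Type*} [Field k] [IsRealClosed k] [CommRing A] [Algebra k A]
    [Algebra.FiniteType k A]
    (hW : topologicalKrullDim (closure (rationalPoints k A)) ≤ 1) :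
    pythagorasNumber A < ⊤ := by
  have : Invertible (2 : A) :=
    ⟨algebraMap k A 2⁻¹, by
      rw [← map_ofNat (algebraMap k A) 2, ← map_mul, inv_mul_cancel₀ two_ne_zero, map_one], by
      rw [← map_ofNat (algebraMap k A) 2, ← map_mul, mul_inv_cancel₀ two_ne_zero, map_one]⟩
  have : IsNoetherianRing A := Algebra.FiniteType.isNoetherianRing k A
  obtain ⟨ψ, hψ⟩ := exists_finite_algHom_of_ringKrullDim_le_one (k := k)
    ((ringKrullDim_quotient_le_topologicalKrullDim
      (zeroLocus_sumSqSupport_subset_closure (k := k) (A := A))).trans hW)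
  obtain ⟨r, hr⟩ := IsRealClosed.exists_sumsOfNSquares_of_finite ψ hψ
  obtain ⟨q, hq⟩ := exists_sumSqSupport_subset_sumsOfNSquares (A := A)
  exact pythagorasNumber_lt_top_of_forall (sumsOfNSquares_subset_of_quotient hq hr)
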